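/- Let $\mu$ be a probability measure on $\mathbb{R}$ all of whose moments $s_m(\mu)=\int x^m\,d\mu$ are finite. A pair of sequences $J(\mu)=(\beta_0,\beta_1,\dots;\gamma_0,\gamma_1,\dots)$ with $\beta_m\in\mathbb{R}$, $\gamma_m\ge 0$ is called a sequence of Jacobi parameters of $\mu$ if the monic polynomials given by $P_{-1}=0$, $P_0=1$, $xP_m=P_{m+1}+\beta_mP_m+\gamma_{m-1}P_{m-1}$ are orthogonal with respect to $\mu$. If some $\gamma_m$ vanishes, the terms after the first vanishing $\gamma_m$ are arbitrary (with $\gamma_m\ge0$), and in statements about Jacobi parameters being equal or depending polynomially on $t$ they are disregarded. The free cumulants $r_n(\mu)$, $n\ge1$, are defined by $s_m(\mu)=\sum_{\pi\in \mathrm{NC}(m)}\prod_{V\in\pi}r_{|V|}(\mu)$, $m\ge1$, where $\mathrm{NC}(m)$ is the set of noncrossing partitions of $\{1,\dots,m\}$. For real $t\ge0$, $\mu^{\boxplus t}$ denotes a probability measure with finite moments and $r_n(\mu^{\boxplus t})=t\,r_n(\mu)$ for all $n\ge1$. The measure $\mu$ is $\boxplus$-infinitely divisible if for every integer $n\ge1$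 there is a probability measure $\nu$ with finite moments such that $\mu=\nu^{\boxplus n}$, that is, $r_k(\mu)=n\,r_k(\nu)$ for all $k\ge1$. A free Meixner distribution is a probability measure with finite moments and with Jacobi parameters of the form $(\beta_0,b+\beta_0,b+\beta_0,\dots;\gamma_0,c+\gamma_0,c+\gamma_0,\dots)$, where $\gamma_0\ge0$, $c+\gamma_0\ge0$. **Theorem.** Let $\mu$ have Jacobi parameters $J(\mu)=(\beta_0,\beta_1,\dots;\gamma_0,\gamma_1,\dots)$. 1. Suppose that for integers $t\ge1$ the free powers have Jacobi parameters $J(\mu^{\boxplus t})=(\beta_0(t),\beta_1(t),\dots;\gamma_0(t),\gamma_1(t),\dots)$ and that, for each $m$, $\beta_m(t)$ and $\gamma_m(t)$ are polynomials in $t$. Then $$\beta_1=\beta_2=\beta_3=\cdots\quad\text{and}\quad\gamma_1=\gamma_2=\gamma_3=\cdots, \tag{$*$}$$ so that $\mu$ is a free Meixner distribution. 2. Conversely, suppose that $(*)$ holds, and put $b=\beta_1-\beta_0$, $c=\gamma_1-\gamma_0$. Then: (a) for every real $t\ge0$ with $c+t\gamma_0\ge0$ the measure $\mu^{\boxplus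 t}$ exists, is unique, and $$J(\mu^{\boxplus t})=(\beta_0t,\ b+\beta_0t,\ b+\beta_0t,\dots;\ \gamma_0t,\ c+\gamma_0t,\ c+\gamma_0t,\dots);$$ (b) $\mu$ is $\boxplus$-infinitely divisible if and only if $c\ge0$; (c) if $c\ge0$, then for all complex $z$ in a neighbourhood of $0$, $$R^\mu(z)=\sum_{k\ge1}r_k(\mu)z^k=\beta_0z+\gamma_0z^2\int_{\mathbb{R}}\frac{d\rho(x)}{1-zx},$$ where $\rho$ has Jacobi parameters $J(\rho)=(b,b,b,\dots;c,c,c,\dots)$, so that $\rho$ is the semicircular distribution with mean $b$ and variance $c$, i.e. $d\rho(x)=\frac{1}{2\pi c}\sqrt{(4c-(x-b)^2)_+}\,dx$ if $c>0$ and $\rho=\delta_b$ if $c=0$. -/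

import Mathlib

open MeasureTheory Polynomial Filter Topology

noncomputable section

namespace FreeMeixner

/-- Probability measures on the real line all of whose moments are finite. -/
structure IsMomentLaw (μ : Measure ℝ) : Prop where
  isProbabilityMeasure : IsProbabilityMeasure μ
  integrable_pow : ∀ n : ℕ, Integrable (fun x : ℝ => x ^ n) μ

/-- The moment `s_m(μ) = ∫ x ^ m dμ(x)`. -/
def moment (μ : Measure ℝ) (m : ℕ) : ℝ := ∫ x, x ^ m ∂μ

/-! ### Jacobi parameters -/

/-- The monic polynomials determined by the three-term recurrence
`x P_m = P_{m+1} + β_m P_m + γ_{m-1} P_{m-1}`, `P_0 = 1`, `P_{-1} = 0`. -/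
def jacobiPoly (β γ : ℕ → ℝ) : ℕ → ℝ[X]
  | 0 => 1
  | 1 => X - C (β 0)
  | m + 2 => (X - C (β (m + 1))) * jacobiPoly β γ (m + 1) - C (γ m) * jacobiPoly β γ m

/-- `J(μ) = (β_0, β_1, …; γ_0, γ_1, …)`: the `γ_m` are nonnegative and the monic polynomials of the
recurrence are orthogonal with respect to `μ`. If `γ_m = 0` for some `m`, then `P_{m+1}` and all
later polynomials vanish `μ`-almost everywhere, so that the terms after the first vanishing `γ_m`
are not constrained by the orthogonality. -/
def IsJacobi (μ : Measure ℝ) (β γ : ℕ → ℝ) : Prop :=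
  (∀ m, 0 ≤ γ m) ∧
    ∀ i j, i ≠ j → ∫ x, (jacobiPoly β γ i).eval x * (jacobiPoly β γ j).eval x ∂μ = 0

/-- The terms `β_m`, `γ_m` are genuine, i.e. they do not come after a vanishing `γ_k`. -/
def IsGenuine (γ : ℕ → ℝ) (m : ℕ) : Prop := ∀ k < m, γ k ≠ 0

/-- `β_1 = β_2 = …` and `γ_1 = γ_2 = …`, where the terms after the first vanishing `γ_m` are
disregarded. -/
def ConstantFromOne (β γ : ℕ → ℝ) : Prop :=
  ∀ m, 1 ≤ m → IsGenuine γ m → β m = β 1 ∧ γ m = γ 1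

/-- The sequence `(u, v, v, v, …)`. -/
def headTail (u v : ℝ) : ℕ → ℝ
  | 0 => u
  | _ + 1 => v

/-- Free Meixner distributions: measures with Jacobi parameters
`(β₀, b + β₀, b + β₀, …; γ₀, c + γ₀, c + γ₀, …)` where `γ₀ ≥ 0` and `c + γ₀ ≥ 0`. -/
def IsFreeMeixner (μ : Measure ℝ) : Prop :=
  IsMomentLaw μ ∧ ∃ β₀ γ₀ b c : ℝ, 0 ≤ γ₀ ∧ 0 ≤ c + γ₀ ∧
    IsJacobi μ (headTail β₀ (b + β₀)) (headTail γ₀ (c + γ₀))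

/-! ### Free cumulants -/

/-- Noncrossing partitions of an `m`-element linearly ordered set. -/
def IsNoncrossing {m : ℕ} (π : Finpartition (Finset.univ : Finset (Fin m))) : Prop :=
  ∀ V ∈ π.parts, ∀ W ∈ π.parts, ∀ x₁ x₂ x₃ x₄ : Fin m,
    x₁ < x₂ → x₂ < x₃ → x₃ < x₄ → x₁ ∈ V → x₃ ∈ V → x₂ ∈ W → x₄ ∈ W → V = W

open Classical in
/-- The set `NC(m)` of noncrossing partitions of an `m`-element linearly ordered set. -/
def NC (m : ℕ) : Finset (Finpartition (Finset.univ : Finset (Fin m))) :=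
  Finset.univ.filter IsNoncrossing

open Classical in
/-- Solution `r` of the moment-cumulant formula `s_m = ∑_{π ∈ NC(m)} ∏_{V ∈ π} r_{|V|}`, `m ≥ 1`:
the one-block partition contributes `r_m`, all other partitions have blocks of size less than `m`.
See `moment_cumulant`. -/
def freeCumulantOf (s : ℕ → ℝ) (m : ℕ) : ℝ :=
  s m - ∑ π ∈ (NC m).filter (fun π => ∀ V ∈ π.parts, V.card < m),
    ∏ V ∈ π.parts, if _h : V.card < m then freeCumulantOf s V.card else 0
termination_by m

/-- The free cumulant `r_m(μ)`, `m ≥ 1`. -/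
def freeCumulant (μ : Measure ℝ) (m : ℕ) : ℝ := freeCumulantOf (moment μ) m

theorem moment_cumulant (s : ℕ → ℝ) (m : ℕ) (hm : 1 ≤ m) :
    s m = ∑ π ∈ NC m, ∏ V ∈ π.parts, freeCumulantOf s V.card := by
  classical
  have hne : (Finset.univ : Finset (Fin m)) ≠ ⊥ := by
    have : Nonempty (Fin m) := ⟨⟨0, hm⟩⟩
    exact Finset.univ_nonempty.ne_empty
  rw [← Finset.sum_filter_add_sum_filter_not (NC m) (fun π => ∀ V ∈ π.parts, V.card < m)]
  have hset : (NC m).filter (fun π => ¬ ∀ V ∈ π.parts, V.card < m)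
      = {Finpartition.indiscrete hne} := by
    ext π
    simp only [NC, Finset.mem_filter, Finset.mem_univ, true_and, Finset.mem_singleton]
    constructor
    · rintro ⟨-, h⟩
      push Not at h
      obtain ⟨V, hV, hc⟩ := h
      have hVu : V = Finset.univ := by
        apply Finset.eq_univ_of_card
        have := Finset.card_le_univ V
        simp only [Fintype.card_fin] at this ⊢
        omega
      subst hVu
      ext W
      simp only [Finpartition.indiscrete, Finset.mem_singleton]
      constructor
      · intro hW
        obtain ⟨a, ha⟩ := π.nonempty_of_mem_parts hW
        exact π.eq_of_mem_parts hW hV ha (Finset.mem_univ a)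
      · rintro rfl
        exact hV
    · rintro rfl
      refine ⟨?_, ?_⟩
      · intro V hV W hW _ _ _ _ _ _ _ _ _ _ _
        simp only [Finpartition.indiscrete, Finset.mem_singleton] at hV hW
        rw [hV, hW]
      · intro h
        have := h Finset.univ (by simp [Finpartition.indiscrete])
        simp at this
  rw [hset, Finset.sum_singleton]
  have h1 : ∏ V ∈ (Finpartition.indiscrete hne).parts, freeCumulantOf s V.card
      = freeCumulantOf s m := by
    simp [Finpartition.indiscrete]
  rw [h1, freeCumulantOf.eq_1 s m]
  have h2 : ∀ π ∈ (NC m).filter (fun π => ∀ V ∈ π.parts, V.card < m),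
      (∏ V ∈ π.parts, if _h : V.card < m then freeCumulantOf s V.card else 0)
        = ∏ V ∈ π.parts, freeCumulantOf s V.card := by
    intro π hπ
    refine Finset.prod_congr rfl fun V hV => ?_
    rw [dif_pos ((Finset.mem_filter.mp hπ).2 V hV)]
  rw [Finset.sum_congr rfl h2]
  ring

/-! ### Free convolution powers -/

/-- `ν` is a free convolution power `μ^{⊞ t}`: a probability measure with finite moments
whose free cumulants are `r_n(ν) = t r_n(μ)`. -/
def IsFreePower (μ : Measure ℝ) (t : ℝ) (ν : Measure ℝ) : Prop :=
  IsMomentLaw ν ∧ ∀ n, 1 ≤ n → freeCumulant ν n = t * freeCumulant μ n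

/-- `⊞`-infinite divisibility: for every `n ≥ 1` the measure `μ` is the `n`-th free convolution
power of some `ν`. -/
def IsFreelyInfinitelyDivisible (μ : Measure ℝ) : Prop :=
  ∀ n : ℕ, 1 ≤ n → ∃ ν : Measure ℝ, IsMomentLaw ν ∧ IsFreePower ν n μ

open Classical in
/-- The semicircular distribution with mean `b` and variance `c ≥ 0`
(the point mass at `b` if `c = 0`). -/
def semicircular (b c : ℝ) : Measure ℝ :=
  if c = 0 then Measure.dirac b
  else volume.withDensity
    (fun x => ENNReal.ofReal (Real.sqrt (4 * c - (x - b) ^ 2) / (2 * Real.pi * c)))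

end FreeMeixner

end

/-! Everything rests on an explicit formula for free cumulants. Let `M` be the moment series with
Jacobi parameters `(β₀, b + β₀, …; γ₀, c + γ₀, …)`, let `N` be the series with the first parameters
removed, and let `Q` be the series with constant parameters `b`, `c`. The continued fractions for
`M` and `N` give `N = M · Q(X M)`, hence `M = 1 + β₀ (X M) + γ₀ (X M)² Q(X M)`. Comparison with `M =
1 + ∑ r_k (X M)^k` yields `r_1 = β₀` and `r_{k+2} = γ₀ s_k(ρ)`, where `s_k(ρ)` are the moments with
parameters `b`, `c` (`freeCumulantOf_meixner`). Multiplying all cumulants by `t` therefore replaces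
`β₀`, `γ₀` by `β₀ t`, `γ₀ t` and leaves `b`, `c` alone.

The converse part follows. Existence comes from the spectral measure of a bounded Jacobi operator
(`exists_isJacobi_headTail`), uniqueness from compact support (`eq_of_moment_eq`). An `n`-th root
has formal parameters `γ₀ / n` and `c + γ₀ / n`, so roots of all orders exist exactly when `c ≥ 0`.
The `R`-transform is the generating series of the semicircular moments.

For the direct part, the cumulants of `μ` are compared with those of the Meixner model having the
same `β₀`, `β₁`, `γ₀`, `γ₁`. Let `N` be the first order where they could differ, by `δ`. For every
integer `t ≥ 1` the moments of the `t`-th power and of its model agree below order `N` and differ by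
`t δ` in order `N`. This difference is a product of model `γ`'s times the first difference of Jacobi
parameters (`jacobiMoment_first_difference`). Beyond the orders fixed by the case `t = 1`, the
product contains the factor `c + γ₀ t`. Polynomial dependence then makes `δ` equal to `c + γ₀ t`
times a polynomial in `t`, and the root `t = -c / γ₀` gives `δ = 0` (`eq_zero_of_mul_eval_eq`). -/

namespace FreeMeixner

/-! ### Weighted sums over noncrossing partitions and their recursion -/

section Noncrossing

variable {α : Type*} [LinearOrder α]

/-- `P` is the set of blocks of a noncrossing partition of the finite set `S`. -/
structure IsNCPartition (S : Finset α) (P : Finset (Finset α)) : Prop where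
  nonempty : ∀ V ∈ P, V.Nonempty
  subset : ∀ V ∈ P, V ⊆ S
  cover : ∀ x ∈ S, ∃ V ∈ P, x ∈ V
  eq_of_mem : ∀ V ∈ P, ∀ W ∈ P, ∀ x, x ∈ V → x ∈ W → V = W
  noncrossing : ∀ V ∈ P, ∀ W ∈ P, ∀ x₁ x₂ x₃ x₄ : α,
    x₁ < x₂ → x₂ < x₃ → x₃ < x₄ → x₁ ∈ V → x₃ ∈ V → x₂ ∈ W → x₄ ∈ W → V = W

open Classical in
/-- The noncrossing partitions of the finite set `S`, as sets of blocks. -/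
noncomputable def ncPartitions (S : Finset α) : Finset (Finset (Finset α)) :=
  S.powerset.powerset.filter (IsNCPartition S)

theorem mem_ncPartitions {S : Finset α} {P : Finset (Finset α)} :
    P ∈ ncPartitions S ↔ IsNCPartition S P := by
  simp only [ncPartitions, Finset.mem_filter, Finset.mem_powerset, and_iff_right_iff_imp]
  intro h V hV
  exact Finset.mem_powerset.2 (h.subset V hV)

/-- The sum over noncrossing partitions of `S` of the products of `r` evaluated at the total weights
of the blocks. -/
noncomputable def ncSum (r : ℕ → ℝ) (ω : α → ℕ) (S : Finset α) : ℝ :=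
  ∑ P ∈ ncPartitions S, ∏ V ∈ P, r (∑ x ∈ V, ω x)

theorem IsNCPartition.filter_subset {S A : Finset α} {P : Finset (Finset α)}
    (h : IsNCPartition S P) (hA : A ⊆ S) (hP : ∀ V ∈ P, ∀ x ∈ V, x ∈ A → V ⊆ A) :
    IsNCPartition A (P.filter (· ⊆ A)) where
  nonempty V hV := h.nonempty V (Finset.mem_filter.1 hV).1
  subset V hV := (Finset.mem_filter.1 hV).2
  cover x hx := by
    obtain ⟨V, hV, hxV⟩ := h.cover x (hA hx)
    exact ⟨V, Finset.mem_filter.2 ⟨hV, hP V hV x hxV hx⟩, hxV⟩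
  eq_of_mem V hV W hW := h.eq_of_mem V (Finset.mem_filter.1 hV).1 W (Finset.mem_filter.1 hW).1
  noncrossing V hV W hW := h.noncrossing V (Finset.mem_filter.1 hV).1 W (Finset.mem_filter.1 hW).1

/-- A crossing between a block in `A` and a block in `C`, whichever starts first, places a point of
`C` strictly between two points of `A`; `hc` forbids this. -/
theorem IsNCPartition.union {A C : Finset α} {P Q : Finset (Finset α)}
    (hP : IsNCPartition A P) (hQ : IsNCPartition C Q) (hd : Disjoint A C)
    (hc : ∀ x ∈ A, ∀ z ∈ A, ∀ y ∈ C, x < y → ¬ y < z) : IsNCPartition (A ∪ C) (P ∪ Q) where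
  nonempty V hV := (Finset.mem_union.1 hV).elim (hP.nonempty V) (hQ.nonempty V)
  subset V hV := (Finset.mem_union.1 hV).elim
    (fun h => (hP.subset V h).trans Finset.subset_union_left)
    (fun h => (hQ.subset V h).trans Finset.subset_union_right)
  cover x hx := by
    rcases Finset.mem_union.1 hx with h | h
    · obtain ⟨V, hV, hxV⟩ := hP.cover x h
      exact ⟨V, Finset.mem_union_left _ hV, hxV⟩
    · obtain ⟨V, hV, hxV⟩ := hQ.cover x h
      exact ⟨V, Finset.mem_union_right _ hV, hxV⟩
  eq_of_mem V hV W hW x hxV hxW := by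
    rw [Finset.disjoint_left] at hd
    rcases Finset.mem_union.1 hV with h | h <;> rcases Finset.mem_union.1 hW with h' | h'
    · exact hP.eq_of_mem V h W h' x hxV hxW
    · exact (hd (hP.subset V h hxV) (hQ.subset W h' hxW)).elim
    · exact (hd (hP.subset W h' hxW) (hQ.subset V h hxV)).elim
    · exact hQ.eq_of_mem V h W h' x hxV hxW
  noncrossing V hV W hW x₁ x₂ x₃ x₄ h12 h23 h34 h1 h3 h2 h4 := by
    rcases Finset.mem_union.1 hV with h | h <;> rcases Finset.mem_union.1 hW with h' | h'
    · exact hP.noncrossing V h W h' x₁ x₂ x₃ x₄ h12 h23 h34 h1 h3 h2 h4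
    · exact (hc x₁ (hP.subset V h h1) x₃ (hP.subset V h h3) x₂ (hQ.subset W h' h2) h12 h23).elim
    · exact (hc x₂ (hP.subset W h' h2) x₄ (hP.subset W h' h4) x₃ (hQ.subset V h h3) h23 h34).elim
    · exact hQ.noncrossing V h W h' x₁ x₂ x₃ x₄ h12 h23 h34 h1 h3 h2 h4

theorem IsNCPartition.filter_union_left {A C : Finset α} {P Q : Finset (Finset α)}
    (hP : IsNCPartition A P) (hQ : IsNCPartition C Q) (hd : Disjoint A C) :
    (P ∪ Q).filter (· ⊆ A) = P := by
  ext V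
  simp only [Finset.mem_filter, Finset.mem_union]
  constructor
  · rintro ⟨h | h, hV⟩
    · exact h
    · obtain ⟨x, hx⟩ := hQ.nonempty V h
      exact (Finset.disjoint_left.1 hd (hV hx) (hQ.subset V h hx)).elim
  · exact fun h => ⟨Or.inl h, hP.subset V h⟩

/-- Noncrossing partitions of `A ∪ C` that split into a partition of `A` and one of `C` are pairs of
noncrossing partitions, if no element of `C` lies between elements of `A`. -/
theorem sum_ncPartitions_union {A C : Finset α} (hd : Disjoint A C)
    (hc : ∀ x ∈ A, ∀ z ∈ A, ∀ y ∈ C, x < y → ¬ y < z) (φ ψ : Finset (Finset α) → ℝ) :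
    ∑ P ∈ (ncPartitions (A ∪ C)).filter (fun P => ∀ V ∈ P, V ⊆ A ∨ V ⊆ C),
      φ (P.filter (· ⊆ A)) * ψ (P.filter (· ⊆ C))
      = (∑ P ∈ ncPartitions A, φ P) * ∑ P ∈ ncPartitions C, ψ P := by
  rw [Finset.sum_mul_sum, ← Finset.sum_product']
  refine Finset.sum_nbij' (fun P => (P.filter (· ⊆ A), P.filter (· ⊆ C))) (fun p => p.1 ∪ p.2)
    ?_ ?_ ?_ ?_ ?_
  · intro P hP
    simp only [Finset.mem_filter, mem_ncPartitions] at hP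
    obtain ⟨h, hs⟩ := hP
    rw [Finset.disjoint_left] at hd
    simp only [Finset.mem_product, mem_ncPartitions]
    refine ⟨h.filter_subset Finset.subset_union_left ?_,
      h.filter_subset Finset.subset_union_right ?_⟩
    · intro V hV x hx hxA
      exact (hs V hV).resolve_right fun h' => hd hxA (h' hx)
    · intro V hV x hx hxA
      exact (hs V hV).resolve_left fun h' => hd (h' hx) hxA
  · rintro ⟨P, Q⟩ hPQ
    simp only [Finset.mem_product, mem_ncPartitions] at hPQ
    simp only [Finset.mem_filter, mem_ncPartitions]
    refine ⟨hPQ.1.union hPQ.2 hd hc, fun V hV => ?_⟩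
    exact (Finset.mem_union.1 hV).imp (hPQ.1.subset V) (hPQ.2.subset V)
  · intro P hP
    simp only [Finset.mem_filter] at hP
    ext V
    simp only [Finset.mem_union, Finset.mem_filter]
    have := hP.2 V
    tauto
  · rintro ⟨P, Q⟩ hPQ
    simp only [Finset.mem_product, mem_ncPartitions] at hPQ
    refine Prod.ext (hPQ.1.filter_union_left hPQ.2 hd) ?_
    simp only
    rw [Finset.union_comm]
    exact hPQ.2.filter_union_left hPQ.1 hd.symm
  · intro P _
    rfl

theorem IsNCPartition.image_erase {a b : α} {C : Finset α} {P : Finset (Finset α)}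
    (h : IsNCPartition (insert a C) P) (ha : a ∉ C) (hab : ∃ V ∈ P, a ∈ V ∧ b ∈ V) (hne : a ≠ b) :
    IsNCPartition C (P.image (·.erase a)) where
  nonempty V' hV' := by
    obtain ⟨V, hV, rfl⟩ := Finset.mem_image.1 hV'
    obtain ⟨W, hW, haW, hbW⟩ := hab
    obtain ⟨x, hx⟩ := h.nonempty V hV
    by_cases hxa : x = a
    · subst hxa
      obtain rfl := h.eq_of_mem V hV W hW x hx haW
      exact ⟨b, Finset.mem_erase.2 ⟨hne.symm, hbW⟩⟩
    · exact ⟨x, Finset.mem_erase.2 ⟨hxa, hx⟩⟩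
  subset V' hV' := by
    obtain ⟨V, hV, rfl⟩ := Finset.mem_image.1 hV'
    intro x hx
    rw [Finset.mem_erase] at hx
    exact (Finset.mem_insert.1 (h.subset V hV hx.2)).resolve_left hx.1
  cover x hx := by
    obtain ⟨V, hV, hxV⟩ := h.cover x (Finset.mem_insert_of_mem hx)
    exact ⟨V.erase a, Finset.mem_image_of_mem _ hV,
      Finset.mem_erase.2 ⟨fun h => ha (h ▸ hx), hxV⟩⟩
  eq_of_mem V' hV' W' hW' x hx hx' := by
    obtain ⟨V, hV, rfl⟩ := Finset.mem_image.1 hV'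
    obtain ⟨W, hW, rfl⟩ := Finset.mem_image.1 hW'
    rw [h.eq_of_mem V hV W hW x (Finset.mem_of_mem_erase hx) (Finset.mem_of_mem_erase hx')]
  noncrossing V' hV' W' hW' x₁ x₂ x₃ x₄ h12 h23 h34 h1 h3 h2 h4 := by
    obtain ⟨V, hV, rfl⟩ := Finset.mem_image.1 hV'
    obtain ⟨W, hW, rfl⟩ := Finset.mem_image.1 hW'
    rw [h.noncrossing V hV W hW x₁ x₂ x₃ x₄ h12 h23 h34 (Finset.mem_of_mem_erase h1)
      (Finset.mem_of_mem_erase h3) (Finset.mem_of_mem_erase h2) (Finset.mem_of_mem_erase h4)]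

/-- Adjoin `a` to those sets that contain `b`. -/
def adjoinTo (a b : α) (V : Finset α) : Finset α := if b ∈ V then insert a V else V

theorem mem_adjoinTo {a b x : α} {V : Finset α} :
    x ∈ adjoinTo a b V ↔ x ∈ V ∨ (b ∈ V ∧ x = a) := by
  unfold adjoinTo
  split_ifs with h <;> simp [h, or_comm]

/-- In a crossing that involves the new minimum `a`, the point `b` can take its place. The only
degenerate case is `x₂ = b`, where the two blocks already share `b`. -/
theorem IsNCPartition.image_adjoinTo {a b : α} {C : Finset α} {Q : Finset (Finset α)}
    (h : IsNCPartition C Q) (hb : b ∈ C) (hbC : ∀ x ∈ C, b ≤ x) (hab : a < b) :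
    IsNCPartition (insert a C) (Q.image (adjoinTo a b)) where
  nonempty V' hV' := by
    obtain ⟨V, hV, rfl⟩ := Finset.mem_image.1 hV'
    obtain ⟨x, hx⟩ := h.nonempty V hV
    exact ⟨x, mem_adjoinTo.2 (Or.inl hx)⟩
  subset V' hV' := by
    obtain ⟨V, hV, rfl⟩ := Finset.mem_image.1 hV'
    intro x hx
    rcases mem_adjoinTo.1 hx with hx | ⟨-, rfl⟩
    · exact Finset.mem_insert_of_mem (h.subset V hV hx)
    · exact Finset.mem_insert_self _ _
  cover x hx := by
    rcases Finset.mem_insert.1 hx with rfl | hx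
    · obtain ⟨V, hV, hbV⟩ := h.cover b hb
      exact ⟨_, Finset.mem_image_of_mem _ hV, mem_adjoinTo.2 (Or.inr ⟨hbV, rfl⟩)⟩
    · obtain ⟨V, hV, hxV⟩ := h.cover x hx
      exact ⟨_, Finset.mem_image_of_mem _ hV, mem_adjoinTo.2 (Or.inl hxV)⟩
  eq_of_mem V' hV' W' hW' x hx hx' := by
    obtain ⟨V, hV, rfl⟩ := Finset.mem_image.1 hV'
    obtain ⟨W, hW, rfl⟩ := Finset.mem_image.1 hW'
    have hlt : ∀ U ∈ Q, a ∉ U := fun U hU haU => (hbC a (h.subset U hU haU)).not_gt hab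
    congr 1
    rcases mem_adjoinTo.1 hx with hx | ⟨hbV, rfl⟩ <;> rcases mem_adjoinTo.1 hx' with hx' | ⟨hbW, he⟩
    · exact h.eq_of_mem V hV W hW x hx hx'
    · exact (hlt V hV (he ▸ hx)).elim
    · exact (hlt W hW hx').elim
    · exact h.eq_of_mem V hV W hW b hbV hbW
  noncrossing V' hV' W' hW' x₁ x₂ x₃ x₄ h12 h23 h34 h1 h3 h2 h4 := by
    obtain ⟨V, hV, rfl⟩ := Finset.mem_image.1 hV'
    obtain ⟨W, hW, rfl⟩ := Finset.mem_image.1 hW'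
    have hge : ∀ U ∈ Q, ∀ x ∈ adjoinTo a b U, a ≤ x := by
      intro U hU x hx
      rcases mem_adjoinTo.1 hx with hx | ⟨-, rfl⟩
      · exact hab.le.trans (hbC x (h.subset U hU hx))
      · exact le_rfl
    have hmem : ∀ U, ∀ x ∈ adjoinTo a b U, a < x → x ∈ U := by
      intro U x hx hlt
      exact (mem_adjoinTo.1 hx).resolve_right fun he => hlt.ne' he.2
    have ha1 := hge V hV x₁ h1
    have h2' := hmem W x₂ h2 (ha1.trans_lt h12)
    have h3' := hmem V x₃ h3 (ha1.trans_lt (h12.trans h23))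
    have h4' := hmem W x₄ h4 (ha1.trans_lt (h12.trans (h23.trans h34)))
    congr 1
    rcases mem_adjoinTo.1 h1 with h1' | ⟨hbV, rfl⟩
    · exact h.noncrossing V hV W hW x₁ x₂ x₃ x₄ h12 h23 h34 h1' h3' h2' h4'
    · rcases (hbC x₂ (h.subset W hW h2')).eq_or_lt with rfl | hlt
      · exact h.eq_of_mem V hV W hW _ hbV h2'
      · exact h.noncrossing V hV W hW b x₂ x₃ x₄ hlt h23 h34 hbV h3' h2' h4'

/-- Contracting the two smallest elements `a < b`, which are assumed to be in the same block. -/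
theorem sum_ncPartitions_contract (r : ℕ → ℝ) (ω : α → ℕ) {a b : α} {C : Finset α} (hb : b ∈ C)
    (hbC : ∀ x ∈ C, b ≤ x) (hab : a < b) :
    ∑ P ∈ (ncPartitions (insert a C)).filter (fun P => ∃ V ∈ P, a ∈ V ∧ b ∈ V),
      ∏ V ∈ P, r (∑ x ∈ V, ω x) = ncSum r (Function.update ω b (ω a + ω b)) C := by
  have ha : a ∉ C := fun h => (hbC a h).not_gt hab
  have herase : ∀ U ⊆ C, (adjoinTo a b U).erase a = U := by
    intro U hU
    have : a ∉ U := fun h => ha (hU h)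
    unfold adjoinTo
    split_ifs <;> simp [this]
  have hadj : ∀ P, IsNCPartition (insert a C) P → (∃ V ∈ P, a ∈ V ∧ b ∈ V) →
      ∀ V ∈ P, adjoinTo a b (V.erase a) = V := by
    rintro P h ⟨W, hW, haW, hbW⟩ V hV
    unfold adjoinTo
    by_cases hbV : b ∈ V
    · obtain rfl := h.eq_of_mem V hV W hW b hbV hbW
      simp [hab.ne', hbV, haW]
    · have : a ∉ V := fun haV => hbV (h.eq_of_mem V hV W hW a haV haW ▸ hbW)
      simp [this, hbV]
  unfold ncSum
  refine Finset.sum_nbij' (fun P => P.image (·.erase a)) (fun Q => Q.image (adjoinTo a b))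
    ?_ ?_ ?_ ?_ ?_
  · intro P hP
    simp only [Finset.mem_filter, mem_ncPartitions] at hP ⊢
    exact hP.1.image_erase ha hP.2 hab.ne
  · intro Q hQ
    simp only [Finset.mem_filter, mem_ncPartitions] at hQ ⊢
    refine ⟨hQ.image_adjoinTo hb hbC hab, ?_⟩
    obtain ⟨V, hV, hbV⟩ := hQ.cover b hb
    exact ⟨_, Finset.mem_image_of_mem _ hV, mem_adjoinTo.2 (Or.inr ⟨hbV, rfl⟩),
      mem_adjoinTo.2 (Or.inl hbV)⟩
  · intro P hP
    simp only [Finset.mem_filter, mem_ncPartitions] at hP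
    rw [Finset.image_image]
    conv_rhs => rw [← Finset.image_id (s := P)]
    exact Finset.image_congr fun V hV => hadj P hP.1 hP.2 V hV
  · intro Q hQ
    rw [mem_ncPartitions] at hQ
    rw [Finset.image_image]
    conv_rhs => rw [← Finset.image_id (s := Q)]
    exact Finset.image_congr fun V hV => herase V (hQ.subset V hV)
  · intro P hP
    simp only [Finset.mem_filter, mem_ncPartitions] at hP
    have hinj : Set.InjOn (fun V : Finset α => V.erase a) (P : Set (Finset α)) := by
      intro V hV W hW he
      rw [← hadj P hP.1 hP.2 V hV, ← hadj P hP.1 hP.2 W hW]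
      exact congrArg _ he
    rw [Finset.prod_image hinj]
    refine Finset.prod_congr rfl fun V hV => ?_
    congr 1
    -- The weight of `a` is moved to `b`, so every block keeps its total weight.
    obtain ⟨h, W, hW, haW, hbW⟩ := hP
    by_cases hbV : b ∈ V
    · obtain rfl := h.eq_of_mem V hV W hW b hbV hbW
      have hb' : b ∈ V.erase a := Finset.mem_erase.2 ⟨hab.ne', hbV⟩
      rw [Finset.sum_update_of_mem hb', ← Finset.add_sum_erase V ω haW,
        ← Finset.add_sum_erase (V.erase a) ω hb', Finset.sdiff_singleton_eq_erase]
      ring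
    · have haV : a ∉ V := fun haV => hbV (h.eq_of_mem V hV W hW a haV haW ▸ hbW)
      rw [Finset.erase_eq_of_notMem haV]
      refine Finset.sum_congr rfl fun x hx => ?_
      rw [Function.update_of_ne]
      rintro rfl
      exact hbV hx

theorem ncSum_congr (r : ℕ → ℝ) {ω ω' : α → ℕ} {S : Finset α} (h : ∀ x ∈ S, ω x = ω' x) :
    ncSum r ω S = ncSum r ω' S := by
  refine Finset.sum_congr rfl fun P hP => Finset.prod_congr rfl fun V hV => ?_
  rw [Finset.sum_congr rfl fun x hx => h x ((mem_ncPartitions.1 hP).subset V hV hx)]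

theorem ncPartitions_empty : ncPartitions (∅ : Finset α) = {∅} := by
  ext P
  rw [mem_ncPartitions, Finset.mem_singleton]
  constructor
  · intro h
    refine Finset.eq_empty_of_forall_notMem fun V hV => ?_
    obtain ⟨x, hx⟩ := h.nonempty V hV
    exact Finset.notMem_empty x (h.subset V hV hx)
  · rintro rfl
    constructor <;> simp

theorem ncSum_empty (r : ℕ → ℝ) (ω : α → ℕ) : ncSum r ω ∅ = 1 := by
  simp [ncSum, ncPartitions_empty]

theorem ncPartitions_singleton (a : α) : ncPartitions ({a} : Finset α) = {{{a}}} := by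
  ext P
  rw [mem_ncPartitions, Finset.mem_singleton]
  constructor
  · intro h
    ext V
    rw [Finset.mem_singleton]
    have hP : ∀ V ∈ P, V = {a} := fun V hV =>
      (h.nonempty V hV).subset_singleton_iff.1 (h.subset V hV)
    constructor
    · exact hP V
    · rintro rfl
      obtain ⟨W, hW, -⟩ := h.cover a (Finset.mem_singleton_self a)
      exact hP W hW ▸ hW
  · rintro rfl
    constructor <;> simp

theorem ncSum_singleton (r : ℕ → ℝ) (ω : α → ℕ) (a : α) : ncSum r ω {a} = r (ω a) := by
  simp [ncSum, ncPartitions_singleton]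

theorem prod_eq_prod_filter_mul {A C : Finset α} {P : Finset (Finset α)} (hd : Disjoint A C)
    (hne : ∀ V ∈ P, V.Nonempty) (hP : ∀ V ∈ P, V ⊆ A ∨ V ⊆ C) (w : Finset α → ℝ) :
    ∏ V ∈ P, w V = (∏ V ∈ P.filter (· ⊆ A), w V) * ∏ V ∈ P.filter (· ⊆ C), w V := by
  rw [← Finset.prod_filter_mul_prod_filter_not P (· ⊆ A)]
  congr 1
  refine Finset.prod_congr (Finset.filter_congr fun V hV => ?_) fun _ _ => rfl
  constructor
  · exact (hP V hV).resolve_left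
  · intro h h'
    obtain ⟨x, hx⟩ := hne V hV
    exact Finset.disjoint_left.1 hd (h' hx) (h hx)

/-- Recursion for sums over noncrossing partitions, according to the second smallest element of the
block that contains the smallest element. -/
theorem ncSum_insert (r : ℕ → ℝ) (ω : α → ℕ) {a : α} {B : Finset α} (ha : ∀ x ∈ B, a < x) :
    ncSum r ω (insert a B) = r (ω a) * ncSum r ω B +
      ∑ b ∈ B, ncSum r ω (B.filter (· < b)) *
        ncSum r (Function.update ω b (ω a + ω b)) (B.filter (b ≤ ·)) := by
  classical
  have haB : a ∉ B := fun h => (ha a h).false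
  set w : Finset α → ℝ := fun V => r (∑ x ∈ V, ω x) with hw
  have hsing : ∑ P ∈ (ncPartitions (insert a B)).filter (fun P => {a} ∈ P), ∏ V ∈ P, w V
      = r (ω a) * ncSum r ω B := by
    have hd : Disjoint {a} B := Finset.disjoint_singleton_left.2 haB
    have := sum_ncPartitions_union hd (by
      simp only [Finset.mem_singleton]
      rintro x rfl z rfl y - h h'
      exact (h.trans h').false) (fun P => ∏ V ∈ P, w V) (fun P => ∏ V ∈ P, w V)
    rw [← ncSum_singleton r ω a]
    unfold ncSum
    rw [← this, ← Finset.insert_eq]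
    have hset : (ncPartitions (insert a B)).filter (fun P => {a} ∈ P)
        = (ncPartitions (insert a B)).filter (fun P => ∀ V ∈ P, V ⊆ {a} ∨ V ⊆ B) := by
      refine Finset.filter_congr fun P hP => ?_
      rw [mem_ncPartitions] at hP
      constructor
      · intro h V hV
        by_cases haV : a ∈ V
        · exact Or.inl (hP.eq_of_mem V hV _ h a haV (Finset.mem_singleton_self a)).le
        · refine Or.inr fun x hx => ?_
          exact (Finset.mem_insert.1 (hP.subset V hV hx)).resolve_left fun he => haV (he ▸ hx)
      · intro h
        obtain ⟨V, hV, haV⟩ := hP.cover a (Finset.mem_insert_self a B)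
        have hs := (h V hV).resolve_right fun h' => haB (h' haV)
        rwa [← (hP.nonempty V hV).subset_singleton_iff.1 hs]
    rw [hset]
    refine Finset.sum_congr rfl fun P hP => ?_
    rw [Finset.mem_filter, mem_ncPartitions] at hP
    exact prod_eq_prod_filter_mul hd hP.1.nonempty hP.2 w
  -- If `b` follows `a` in its block, the points between them are cut off: they carry an independent
  -- partition, and in the remainder `a` and `b` are contracted to one point.
  have hnext : ∀ b ∈ B,
      ∑ P ∈ (ncPartitions (insert a B)).filter
        (fun P => ∃ V ∈ P, a ∈ V ∧ b ∈ V ∧ ∀ x ∈ V, x < b → x = a), ∏ V ∈ P, w V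
      = ncSum r ω (B.filter (· < b)) *
        ncSum r (Function.update ω b (ω a + ω b)) (B.filter (b ≤ ·)) := by
    intro b hb
    have hab := ha b hb
    set A := B.filter (· < b) with hA
    set C := B.filter (b ≤ ·) with hC
    have hbC : b ∈ C := Finset.mem_filter.2 ⟨hb, le_rfl⟩
    have haC : a ∉ C := fun h => haB (Finset.mem_filter.1 h).1
    have hd : Disjoint A (insert a C) := by
      rw [Finset.disjoint_left]
      intro x hx hx'
      rw [hA, Finset.mem_filter] at hx
      rcases Finset.mem_insert.1 hx' with rfl | hx'
      · exact haB hx.1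
      · exact (Finset.mem_filter.1 hx').2.not_gt hx.2
    have hunion : insert a B = A ∪ insert a C := by
      ext x
      simp only [hA, hC, Finset.mem_insert, Finset.mem_union, Finset.mem_filter]
      have := lt_or_ge x b
      tauto
    have hconv : ∀ x ∈ A, ∀ z ∈ A, ∀ y ∈ insert a C, x < y → ¬ y < z := by
      intro x hx z hz y hy hxy hyz
      rcases Finset.mem_insert.1 hy with rfl | hy
      · exact (ha x (Finset.mem_filter.1 hx).1).asymm hxy
      · exact (hyz.trans (Finset.mem_filter.1 hz).2).not_ge (Finset.mem_filter.1 hy).2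
    rw [← sum_ncPartitions_contract r ω hbC (fun x hx => (Finset.mem_filter.1 hx).2) hab,
      Finset.sum_filter (s := ncPartitions (insert a C))]
    have := sum_ncPartitions_union hd hconv (fun P => ∏ V ∈ P, w V)
      (fun P => if ∃ V ∈ P, a ∈ V ∧ b ∈ V then ∏ V ∈ P, w V else 0)
    unfold ncSum
    rw [← this, ← hunion]
    simp only [mul_ite, mul_zero]
    rw [← Finset.sum_filter, Finset.filter_filter]
    refine Finset.sum_congr (Finset.filter_congr fun P hP => ?_) fun P hP => ?_
    · rw [mem_ncPartitions] at hP
      constructor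
      · rintro ⟨V, hV, haV, hbV, hmin⟩
        have hVC : V ⊆ insert a C := by
          intro x hx
          rcases lt_or_ge x b with h | h
          · rw [hmin x hx h]
            exact Finset.mem_insert_self _ _
          · rcases Finset.mem_insert.1 (hP.subset V hV hx) with rfl | hxB
            · exact Finset.mem_insert_self _ _
            · exact Finset.mem_insert_of_mem (Finset.mem_filter.2 ⟨hxB, h⟩)
        refine ⟨fun W hW => ?_, V, Finset.mem_filter.2 ⟨hV, hVC⟩, haV, hbV⟩
        by_cases hVW : V = W
        · exact Or.inr (hVW ▸ hVC)
        have hWB : ∀ x ∈ W, x ∈ B := fun x hx =>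
          (Finset.mem_insert.1 (hP.subset W hW hx)).resolve_left fun he =>
            hVW (hP.eq_of_mem V hV W hW a haV (he ▸ hx))
        -- A block other than that of `a` and `b` lies on one side of `b`: points `x < b < y` in it
        -- would give the crossing `a < x < b < y`.
        by_cases hlow : ∃ x ∈ W, x < b
        · obtain ⟨x, hx, hxb⟩ := hlow
          refine Or.inl fun y hy => Finset.mem_filter.2 ⟨hWB y hy, ?_⟩
          by_contra! hby
          rcases hby.eq_or_lt with rfl | hby
          · exact hVW (hP.eq_of_mem V hV W hW b hbV hy)
          · exact hVW (hP.noncrossing V hV W hW a x b y (ha x (hWB x hx)) hxb hby haV hbV hx hy)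
        · push Not at hlow
          exact Or.inr fun y hy =>
            Finset.mem_insert_of_mem (Finset.mem_filter.2 ⟨hWB y hy, hlow y hy⟩)
      · rintro ⟨-, V, hV, haV, hbV⟩
        rw [Finset.mem_filter] at hV
        refine ⟨V, hV.1, haV, hbV, fun x hx hxb => ?_⟩
        exact (Finset.mem_insert.1 (hV.2 hx)).resolve_right fun h =>
          (Finset.mem_filter.1 h).2.not_gt hxb
    · rw [Finset.mem_filter, mem_ncPartitions] at hP
      exact prod_eq_prod_filter_mul hd hP.1.nonempty hP.2.1 w
  rw [← hsing, ← Finset.sum_congr rfl hnext]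
  unfold ncSum
  rw [← Finset.sum_filter_add_sum_filter_not (ncPartitions (insert a B)) (fun P => {a} ∈ P)]
  congr 1
  -- The partitions in which `{a}` is not a block are classified by the successor of `a` in its
  -- block.
  rw [← Finset.sum_biUnion]
  · refine Finset.sum_congr ?_ fun _ _ => rfl
    ext P
    simp only [Finset.mem_filter, Finset.mem_biUnion]
    constructor
    · rintro ⟨hP, hs⟩
      have hP' := mem_ncPartitions.1 hP
      obtain ⟨V, hV, haV⟩ := hP'.cover a (Finset.mem_insert_self a B)
      have hne : (V.erase a).Nonempty := by
        rw [Finset.nonempty_iff_ne_empty]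
        intro he
        apply hs
        have : V = {a} := by rw [← Finset.insert_erase haV, he, Finset.insert_empty]
        exact this ▸ hV
      have hmem := Finset.min'_mem _ hne
      refine ⟨(V.erase a).min' hne, ?_, hP, V, hV, haV, Finset.mem_of_mem_erase hmem, ?_⟩
      · exact (Finset.mem_insert.1 (hP'.subset V hV (Finset.mem_of_mem_erase hmem))).resolve_left
          (Finset.ne_of_mem_erase hmem)
      · intro x hx hlt
        by_contra hxa
        exact (Finset.min'_le _ x (Finset.mem_erase.2 ⟨hxa, hx⟩)).not_gt hlt
    · rintro ⟨b, hb, hP, V, hV, haV, hbV, -⟩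
      refine ⟨hP, fun hs => ?_⟩
      have := (mem_ncPartitions.1 hP).eq_of_mem V hV _ hs a haV (Finset.mem_singleton_self a)
      rw [this, Finset.mem_singleton] at hbV
      exact haB (hbV ▸ hb)
  · intro b hb b' hb' hne
    refine Finset.disjoint_left.2 fun P hP hP' => hne ?_
    rw [Finset.mem_filter] at hP hP'
    obtain ⟨hP0, V, hV, haV, hbV, hmin⟩ := hP
    obtain ⟨-, W, hW, haW, hbW, hmin'⟩ := hP'
    obtain rfl := (mem_ncPartitions.1 hP0).eq_of_mem V hV W hW a haV haW
    rcases lt_trichotomy b b' with h | h | h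
    · exact (haB (hmin' b hbV h ▸ hb)).elim
    · exact h
    · exact (haB (hmin b' hbW h ▸ hb')).elim

/-- Invariance of sums over noncrossing partitions under strictly monotone embeddings. -/
theorem ncSum_map {β : Type*} [LinearOrder β] (r : ℕ → ℝ) (ω : β → ℕ) (f : α ↪o β)
    (S : Finset α) : ncSum r ω (S.map f.toEmbedding) = ncSum r (ω ∘ f) S := by
  have hinj : Function.Injective (Finset.map f.toEmbedding) := Finset.map_injective _
  have hmap : ∀ P : Finset (Finset α), IsNCPartition (S.map f.toEmbedding)
      (P.map ⟨Finset.map f.toEmbedding, hinj⟩) ↔ IsNCPartition S P := by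
    intro P
    constructor
    · intro h
      refine ⟨fun V hV => ?_, fun V hV => ?_, fun x hx => ?_, fun V hV W hW x hxV hxW => ?_,
        fun V hV W hW x₁ x₂ x₃ x₄ h12 h23 h34 h1 h3 h2 h4 => ?_⟩
      · exact Finset.map_nonempty.1 (h.nonempty _ (Finset.mem_map_of_mem _ hV))
      · exact Finset.map_subset_map.1 (h.subset _ (Finset.mem_map_of_mem _ hV))
      · obtain ⟨V', hV', hx'⟩ := h.cover (f x) (Finset.mem_map_of_mem f.toEmbedding hx)
        obtain ⟨V, hV, rfl⟩ := Finset.mem_map.1 hV'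
        exact ⟨V, hV, (Finset.mem_map' f.toEmbedding).1 hx'⟩
      · exact hinj (h.eq_of_mem _ (Finset.mem_map_of_mem _ hV) _ (Finset.mem_map_of_mem _ hW) (f x)
          (Finset.mem_map_of_mem f.toEmbedding hxV) (Finset.mem_map_of_mem f.toEmbedding hxW))
      · exact hinj (h.noncrossing _ (Finset.mem_map_of_mem _ hV) _ (Finset.mem_map_of_mem _ hW)
          (f x₁) (f x₂) (f x₃) (f x₄) (f.lt_iff_lt.2 h12) (f.lt_iff_lt.2 h23) (f.lt_iff_lt.2 h34)
          (Finset.mem_map_of_mem f.toEmbedding h1) (Finset.mem_map_of_mem f.toEmbedding h3)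
          (Finset.mem_map_of_mem f.toEmbedding h2) (Finset.mem_map_of_mem f.toEmbedding h4))
    · intro h
      refine ⟨fun V' hV' => ?_, fun V' hV' => ?_, fun x' hx' => ?_,
        fun V' hV' W' hW' x hxV hxW => ?_,
        fun V' hV' W' hW' x₁ x₂ x₃ x₄ h12 h23 h34 h1 h3 h2 h4 => ?_⟩
      · obtain ⟨V, hV, rfl⟩ := Finset.mem_map.1 hV'
        exact Finset.map_nonempty.2 (h.nonempty V hV)
      · obtain ⟨V, hV, rfl⟩ := Finset.mem_map.1 hV'
        exact Finset.map_subset_map.2 (h.subset V hV)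
      · obtain ⟨x, hx, rfl⟩ := Finset.mem_map.1 hx'
        obtain ⟨V, hV, hxV⟩ := h.cover x hx
        exact ⟨_, Finset.mem_map_of_mem _ hV, Finset.mem_map_of_mem f.toEmbedding hxV⟩
      · obtain ⟨V, hV, rfl⟩ := Finset.mem_map.1 hV'
        obtain ⟨W, hW, rfl⟩ := Finset.mem_map.1 hW'
        obtain ⟨y, hy, rfl⟩ := Finset.mem_map.1 hxV
        rw [h.eq_of_mem V hV W hW y hy ((Finset.mem_map' f.toEmbedding).1 hxW)]
      · obtain ⟨V, hV, rfl⟩ := Finset.mem_map.1 hV'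
        obtain ⟨W, hW, rfl⟩ := Finset.mem_map.1 hW'
        obtain ⟨y₁, hy₁, rfl⟩ := Finset.mem_map.1 h1
        obtain ⟨y₂, hy₂, rfl⟩ := Finset.mem_map.1 h2
        obtain ⟨y₃, hy₃, rfl⟩ := Finset.mem_map.1 h3
        obtain ⟨y₄, hy₄, rfl⟩ := Finset.mem_map.1 h4
        rw [h.noncrossing V hV W hW y₁ y₂ y₃ y₄ (f.lt_iff_lt.1 h12) (f.lt_iff_lt.1 h23)
          (f.lt_iff_lt.1 h34) hy₁ hy₃ hy₂ hy₄]
  unfold ncSum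
  symm
  refine Finset.sum_bij (fun P _ => P.map ⟨Finset.map f.toEmbedding, hinj⟩) ?_ ?_ ?_ ?_
  · intro P hP
    rw [mem_ncPartitions] at hP ⊢
    exact (hmap P).2 hP
  · intro P _ Q _ h
    exact Finset.map_injective _ h
  · intro P' hP'
    rw [mem_ncPartitions] at hP'
    have : ∃ P : Finset (Finset α), P.map ⟨Finset.map f.toEmbedding, hinj⟩ = P' := by
      refine ⟨P'.preimage (Finset.map f.toEmbedding) hinj.injOn, ?_⟩
      ext V'
      simp only [Finset.mem_map, Finset.mem_preimage, Function.Embedding.coeFn_mk]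
      constructor
      · rintro ⟨V, hV, rfl⟩
        exact hV
      · intro hV'
        obtain ⟨V, hV, rfl⟩ := Finset.subset_map_iff.1 (hP'.subset V' hV')
        exact ⟨V, hV', rfl⟩
    obtain ⟨P, rfl⟩ := this
    exact ⟨P, mem_ncPartitions.2 ((hmap P).1 hP'), rfl⟩
  · intro P _
    rw [Finset.prod_map]
    refine Finset.prod_congr rfl fun V _ => ?_
    simp

end Noncrossing

/-- The sum `∑_{π ∈ NC(m)} ∏_{V ∈ π} r_{|V|}`. -/
theorem sum_NC_eq_ncSum (r : ℕ → ℝ) (m : ℕ) :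
    ∑ π ∈ NC m, ∏ V ∈ π.parts, r V.card = ncSum r (fun _ => 1) (Finset.range m) := by
  have hr : Finset.range m = (Finset.univ : Finset (Fin m)).map
      (Fin.valOrderEmb m).toEmbedding := by
    ext x
    simp only [Finset.mem_range, Finset.mem_map, Finset.mem_univ, true_and]
    exact ⟨fun h => ⟨⟨x, h⟩, rfl⟩, fun ⟨y, hy⟩ => hy ▸ y.2⟩
  rw [hr, ncSum_map]
  unfold ncSum
  refine Finset.sum_bij (fun π _ => π.parts) ?_ ?_ ?_ ?_
  · intro π hπ
    simp only [NC, Finset.mem_filter, Finset.mem_univ, true_and] at hπ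
    rw [mem_ncPartitions]
    refine ⟨fun V hV => π.nonempty_of_mem_parts hV, fun V _ => Finset.subset_univ V,
      fun x hx => π.exists_mem hx, fun V hV W hW x hx hx' => π.eq_of_mem_parts hV hW hx hx', hπ⟩
  · intro π _ π' _ h
    exact Finpartition.ext h
  · intro P hP
    rw [mem_ncPartitions] at hP
    refine ⟨Finpartition.ofExistsUnique P (fun V _ => Finset.subset_univ V) ?_ ?_, ?_, rfl⟩
    · intro x hx
      obtain ⟨V, hV, hxV⟩ := hP.cover x hx
      exact ⟨V, ⟨hV, hxV⟩, fun W hW => hP.eq_of_mem W hW.1 V hV x hW.2 hxV⟩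
    · intro h
      simpa using hP.nonempty _ h
    · simp only [NC, Finset.mem_filter, Finset.mem_univ, true_and]
      exact hP.noncrossing
  · intro π _
    simp

/-! ### The functional equation between moments and free cumulants -/

section CumulantSeries

open PowerSeries (mk)

theorem map_addRight_range (i n : ℕ) :
    (Finset.range n).map (OrderEmbedding.addRight i).toEmbedding = Finset.Ico i (i + n) := by
  ext x
  simp only [Finset.mem_map, Finset.mem_range, Finset.mem_Ico]
  constructor
  · rintro ⟨y, hy, rfl⟩
    simp
    omega
  · intro h
    exact ⟨x - i, by omega, by simp; omega⟩

/-- The moments with prescribed free cumulants. -/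
noncomputable def ncMoment (r : ℕ → ℝ) (m : ℕ) : ℝ := ncSum r (fun _ => 1) (Finset.range m)

/-- The sum over noncrossing partitions of an `m`-element set, where the size of the block that
contains the first element is augmented by `j`. -/
noncomputable def ncMomentHead (r : ℕ → ℝ) (j m : ℕ) : ℝ :=
  if m = 0 then 0 else ncSum r (fun x => if x = 0 then j + 1 else 1) (Finset.range m)

/-- This is `ncSum_insert` for a first point of weight `j + 1`: either it is alone, or its successor
`i + 1` leaves a gap of `i` points and absorbs it, becoming a head of weight `j + 2`. -/
theorem ncMomentHead_succ (r : ℕ → ℝ) (j m : ℕ) :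
    ncMomentHead r j (m + 1) = r (j + 1) * ncMoment r m +
      ∑ p ∈ Finset.HasAntidiagonal.antidiagonal m, ncMoment r p.1 * ncMomentHead r (j + 1) p.2 := by
  have h0 : Finset.range (m + 1) = insert 0 (Finset.Ico 1 (1 + m)) := by
    ext x
    simp only [Finset.mem_range, Finset.mem_insert, Finset.mem_Ico]
    omega
  rw [ncMomentHead, if_neg (Nat.succ_ne_zero m), h0, ncSum_insert]
  swap
  · intro x hx
    exact (Finset.mem_Ico.1 hx).1
  have hlow : ∀ i, ncSum r (fun x => if x = 0 then j + 1 else 1) (Finset.Ico 1 (1 + i))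
      = ncMoment r i := by
    intro i
    rw [← map_addRight_range, ncSum_map]
    exact ncSum_congr r fun x _ => by simp
  congr 1
  · rw [hlow]
    simp
  · rw [← map_addRight_range 1 m, Finset.sum_map, map_addRight_range,
      Finset.Nat.sum_antidiagonal_eq_sum_range_succ_mk, Finset.sum_range_succ]
    -- The antidiagonal has one term more than there are successors; it vanishes because
    -- `ncMomentHead` is `0` on the empty set.
    simp only [Nat.sub_self, ncMomentHead, if_true, mul_zero, add_zero]
    refine Finset.sum_congr rfl fun i hi => ?_
    have hi' := Finset.mem_range.1 hi
    simp only [RelEmbedding.coe_toEmbedding, OrderEmbedding.addRight_apply]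
    have h1 : (Finset.Ico 1 (1 + m)).filter (· < i + 1) = Finset.Ico 1 (1 + i) := by
      ext x
      simp only [Finset.mem_filter, Finset.mem_Ico]
      omega
    have h2 : (Finset.Ico 1 (1 + m)).filter (i + 1 ≤ ·)
        = Finset.Ico (i + 1) ((i + 1) + (m - i)) := by
      ext x
      simp only [Finset.mem_filter, Finset.mem_Ico]
      omega
    rw [h1, h2, hlow, if_neg (show ¬ m - i = 0 by omega), ← map_addRight_range, ncSum_map]
    refine congrArg _ (ncSum_congr (α := ℕ) r fun x _ => ?_)
    by_cases hx : x = 0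
    · simp [hx]
    · simp [hx, Function.update_of_ne]

/-- The sequence `r` (from index `1` on) satisfies `M = 1 + ∑_{k ≥ 1} r_k (X M)^k`; the series
`f j` stands for `∑_{k ≥ 1} r_{j + k} (X M)^k`. -/
def IsFreeCumulantSeq (M : PowerSeries ℝ) (r : ℕ → ℝ) : Prop :=
  ∃ f : ℕ → PowerSeries ℝ, M = 1 + f 0 ∧
    ∀ j, f j = PowerSeries.X * M * (PowerSeries.C (r (j + 1)) + f (j + 1))

theorem isFreeCumulantSeq_ncMoment (r : ℕ → ℝ) : IsFreeCumulantSeq (mk (ncMoment r)) r := by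
  refine ⟨fun j => mk (ncMomentHead r j), ?_, fun j => ?_⟩
  · ext m
    rcases m with - | m
    · simp [ncMoment, ncMomentHead, ncSum_empty]
    · simp only [PowerSeries.coeff_mk, map_add, PowerSeries.coeff_one, Nat.succ_ne_zero, if_false,
        zero_add, ncMoment, ncMomentHead]
      exact ncSum_congr r fun x _ => by simp
  · ext m
    rw [mul_assoc]
    rcases m with - | m
    · rw [PowerSeries.coeff_zero_X_mul]
      simp [ncMomentHead]
    · rw [PowerSeries.coeff_succ_X_mul, mul_add, map_add, PowerSeries.coeff_mul_C,
        PowerSeries.coeff_mul, PowerSeries.coeff_mk, ncMomentHead_succ]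
      simp only [PowerSeries.coeff_mk]
      ring

/-- Every `f j` has zero constant term and `X M` can be cancelled, so `r (j + 1)` is the constant
coefficient of `f j / (X M)`, and what remains is `f (j + 1)`. -/
theorem IsFreeCumulantSeq.unique {M : PowerSeries ℝ} {r r' : ℕ → ℝ}
    (h : IsFreeCumulantSeq M r) (h' : IsFreeCumulantSeq M r') (n : ℕ) (hn : 1 ≤ n) :
    r n = r' n := by
  obtain ⟨f, hM, hf⟩ := h
  obtain ⟨f', hM', hf'⟩ := h'
  have hc : ∀ j, PowerSeries.constantCoeff (f j) = 0 := fun j => by rw [hf j]; simp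
  have hc' : ∀ j, PowerSeries.constantCoeff (f' j) = 0 := fun j => by rw [hf' j]; simp
  have hM0 : M ≠ 0 := by
    intro h0
    have := congrArg PowerSeries.constantCoeff hM
    rw [map_add, hc, h0] at this
    simp at this
  have step : ∀ j, f j = f' j → r (j + 1) = r' (j + 1) ∧ f (j + 1) = f' (j + 1) := by
    intro j e
    rw [hf j, hf' j] at e
    have e' := mul_left_cancel₀ (mul_ne_zero PowerSeries.X_ne_zero hM0) e
    have e'' : r (j + 1) = r' (j + 1) := by
      have := congrArg PowerSeries.constantCoeff e'
      simpa [hc, hc'] using this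
    rw [e''] at e'
    exact ⟨e'', add_left_cancel e'⟩
  have hff : ∀ j, f j = f' j := by
    intro j
    induction j with
    | zero => exact add_left_cancel (hM.symm.trans hM')
    | succ j ih => exact (step j ih).2
  obtain ⟨k, rfl⟩ := Nat.exists_eq_add_of_le' hn
  exact (step k (hff k)).1

theorem isFreeCumulantSeq_freeCumulantOf {s : ℕ → ℝ} (hs : s 0 = 1) :
    IsFreeCumulantSeq (mk s) (freeCumulantOf s) := by
  have : s = ncMoment (freeCumulantOf s) := by
    ext m
    rcases Nat.eq_zero_or_pos m with rfl | hm
    · simp [hs, ncMoment, ncSum_empty]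
    · rw [ncMoment, ← sum_NC_eq_ncSum]
      exact moment_cumulant s m hm
  conv_lhs => rw [this]
  exact isFreeCumulantSeq_ncMoment _

/-- If the cumulants below `N` agree, then the differences of the `N`-th moments and of the `N`-th
cumulants agree. -/
theorem sub_eq_freeCumulantOf_sub {s s' : ℕ → ℝ} {N : ℕ}
    (h : ∀ n, 1 ≤ n → n < N → freeCumulantOf s n = freeCumulantOf s' n) :
    s N - s' N = freeCumulantOf s N - freeCumulantOf s' N := by
  classical
  rw [freeCumulantOf.eq_1 s N, freeCumulantOf.eq_1 s' N]
  have : ∀ π ∈ (NC N).filter (fun π => ∀ V ∈ π.parts, V.card < N),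
      (∏ V ∈ π.parts, if _h : V.card < N then freeCumulantOf s V.card else 0)
        = ∏ V ∈ π.parts, if _h : V.card < N then freeCumulantOf s' V.card else 0 := by
    intro π hπ
    refine Finset.prod_congr rfl fun V hV => ?_
    have hlt := (Finset.mem_filter.1 hπ).2 V hV
    rw [dif_pos hlt, dif_pos hlt]
    exact h _ (Finset.card_pos.2 (π.nonempty_of_mem_parts hV)) hlt
  rw [Finset.sum_congr rfl this]
  ring

/-- Moments are determined by free cumulants. -/
theorem eq_of_freeCumulantOf_eq {s s' : ℕ → ℝ} (h0 : s 0 = s' 0) {N : ℕ}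
    (h : ∀ n, 1 ≤ n → n < N → freeCumulantOf s n = freeCumulantOf s' n) (n : ℕ) (hn : n < N) :
    s n = s' n := by
  rcases Nat.eq_zero_or_pos n with rfl | hpos
  · exact h0
  · have := sub_eq_freeCumulantOf_sub (N := n) fun k hk hkn => h k hk (hkn.trans hn)
    rw [h n hpos hn, sub_self] at this
    exact sub_eq_zero.1 this

end CumulantSeries

/-! ### Moments as functions of Jacobi parameters -/

section JacobiMoments

/-- The numbers `L(x ^ n P_k)`, where `P_k` are the polynomials with recurrence coefficients `β`, `γ`
and `L` is the functional that makes them orthogonal. -/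
def jacobiEntry (β γ : ℕ → ℝ) : ℕ → ℕ → ℝ
  | 0, 0 => 1
  | 0, _ + 1 => 0
  | n + 1, 0 => jacobiEntry β γ n 1 + β 0 * jacobiEntry β γ n 0
  | n + 1, k + 1 => jacobiEntry β γ n (k + 2) + β (k + 1) * jacobiEntry β γ n (k + 1) +
      γ k * jacobiEntry β γ n k

/-- The moments with Jacobi parameters `β`, `γ`. -/
def jacobiMoment (β γ : ℕ → ℝ) (n : ℕ) : ℝ := jacobiEntry β γ n 0

/-- The sequence without its first term. -/
def shift (β : ℕ → ℝ) (n : ℕ) : ℝ := β (n + 1)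

/-- The generating series of the moments with Jacobi parameters `β`, `γ`. -/
noncomputable def jacobiSeries (β γ : ℕ → ℝ) : PowerSeries ℝ := PowerSeries.mk (jacobiMoment β γ)

variable (β γ : ℕ → ℝ)

@[simp]
theorem jacobiMoment_zero : jacobiMoment β γ 0 = 1 := by simp [jacobiMoment, jacobiEntry]

@[simp]
theorem jacobiMoment_one : jacobiMoment β γ 1 = β 0 := by simp [jacobiMoment, jacobiEntry]

theorem jacobiMoment_two : jacobiMoment β γ 2 = β 0 ^ 2 + γ 0 := by
  simp [jacobiMoment, jacobiEntry]
  ring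

theorem constantCoeff_jacobiSeries : PowerSeries.constantCoeff (jacobiSeries β γ) = 1 := by
  rw [← PowerSeries.coeff_zero_eq_constantCoeff_apply]
  simp [jacobiSeries]

/-- Each use of the homogeneous system gains a factor `X`, so every `D k` is divisible by all powers
of `X`. This identifies two solutions of the path recurrences below. -/
theorem eq_zero_of_recurrence {D : ℕ → PowerSeries ℝ} {b g : ℕ → ℝ}
    (h0 : D 0 = PowerSeries.X * (D 1 + PowerSeries.C (b 0) * D 0))
    (h : ∀ k, D (k + 1) = PowerSeries.X * (D (k + 2) + PowerSeries.C (b (k + 1)) * D (k + 1) +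
      PowerSeries.C (g k) * D k)) (k : ℕ) : D k = 0 := by
  have key : ∀ n k, PowerSeries.X ^ n ∣ D k := by
    intro n
    induction n with
    | zero => simp
    | succ n ih =>
      rintro (_ | k)
      · rw [h0, pow_succ']
        exact mul_dvd_mul_left _ (dvd_add (ih _) ((ih _).mul_left _))
      · rw [h, pow_succ']
        exact mul_dvd_mul_left _
          (dvd_add (dvd_add (ih _) ((ih _).mul_left _)) ((ih _).mul_left _))
  ext n
  exact PowerSeries.X_pow_dvd_iff.1 (key (n + 1) k) n n.lt_succ_self

theorem jacobiEntry_series_zero :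
    PowerSeries.mk (fun n => jacobiEntry β γ n 0) = 1 + PowerSeries.X *
      (PowerSeries.mk (fun n => jacobiEntry β γ n 1) +
        PowerSeries.C (β 0) * PowerSeries.mk (fun n => jacobiEntry β γ n 0)) := by
  ext n
  rcases n with - | n
  · rw [map_add, PowerSeries.coeff_zero_X_mul]
    simp [jacobiEntry]
  · simp [PowerSeries.coeff_succ_X_mul, jacobiEntry, PowerSeries.coeff_one]

theorem jacobiEntry_series_succ (k : ℕ) :
    PowerSeries.mk (fun n => jacobiEntry β γ n (k + 1)) = PowerSeries.X *
      (PowerSeries.mk (fun n => jacobiEntry β γ n (k + 2)) +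
        PowerSeries.C (β (k + 1)) * PowerSeries.mk (fun n => jacobiEntry β γ n (k + 1)) +
        PowerSeries.C (γ k) * PowerSeries.mk (fun n => jacobiEntry β γ n k)) := by
  ext n
  rcases n with - | n
  · rw [PowerSeries.coeff_zero_X_mul]
    simp [jacobiEntry]
  · simp [PowerSeries.coeff_succ_X_mul, jacobiEntry]

/-- The continued fraction expansion of the moment series. -/
theorem jacobiSeries_eq : jacobiSeries β γ = 1 + PowerSeries.C (β 0) * PowerSeries.X *
    jacobiSeries β γ + PowerSeries.C (γ 0) * PowerSeries.X ^ 2 * jacobiSeries β γ *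
      jacobiSeries (shift β) (shift γ) := by
  -- `jacobiEntry β γ n k` counts weighted Motzkin paths of length `n` from height `0` to `k`.
  -- Cutting at the last departure from height `0` suggests that level `k + 1` is `γ₀ X M` times
  -- level `k` of the shifted parameters; the difference `D` solves the homogeneous system.
  have key := eq_zero_of_recurrence (b := shift β) (g := shift γ)
    (D := fun k => PowerSeries.mk (fun n => jacobiEntry β γ n (k + 1)) -
      PowerSeries.C (γ 0) * PowerSeries.X * jacobiSeries β γ *
        PowerSeries.mk (fun n => jacobiEntry (shift β) (shift γ) n k))
    (by
      have h1 := jacobiEntry_series_succ β γ 0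
      have h2 := jacobiEntry_series_zero (shift β) (shift γ)
      simp only [shift, zero_add] at h1 h2 ⊢
      unfold jacobiSeries jacobiMoment
      linear_combination h1 - PowerSeries.C (γ 0) * PowerSeries.X *
        PowerSeries.mk (fun n => jacobiEntry β γ n 0) * h2)
    (by
      intro k
      have h1 := jacobiEntry_series_succ β γ (k + 1)
      have h2 := jacobiEntry_series_succ (shift β) (shift γ) k
      simp only [shift] at h1 h2 ⊢
      unfold jacobiSeries jacobiMoment
      linear_combination h1 - PowerSeries.C (γ 0) * PowerSeries.X *
        PowerSeries.mk (fun n => jacobiEntry β γ n 0) * h2) 0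
  have h0 := jacobiEntry_series_zero β γ
  simp only [zero_add] at key
  unfold jacobiSeries jacobiMoment at key ⊢
  linear_combination h0 + PowerSeries.X * key

theorem jacobiMoment_add_two (n : ℕ) : jacobiMoment β γ (n + 2) = β 0 * jacobiMoment β γ (n + 1) +
    γ 0 * ∑ p ∈ Finset.HasAntidiagonal.antidiagonal n,
      jacobiMoment β γ p.1 * jacobiMoment (shift β) (shift γ) p.2 := by
  have h := congrArg (PowerSeries.coeff (n + 2)) (jacobiSeries_eq β γ)
  have e : ∀ M : PowerSeries ℝ, PowerSeries.C (γ 0) * PowerSeries.X ^ 2 * jacobiSeries β γ * M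
    = PowerSeries.C (γ 0) * (PowerSeries.X ^ 2 * (jacobiSeries β γ * M)) := fun M => by ring
  rw [map_add, map_add, e, mul_assoc (PowerSeries.C (β 0)), PowerSeries.coeff_C_mul,
    PowerSeries.coeff_C_mul, PowerSeries.coeff_succ_X_mul, PowerSeries.coeff_X_pow_mul,
    PowerSeries.coeff_mul] at h
  simpa [jacobiSeries, PowerSeries.coeff_one, add_comm] using h

variable {β γ}

/-- The moments depend on the genuine Jacobi parameters only. -/
theorem jacobiMoment_congr {β' γ' : ℕ → ℝ}
    (h : ∀ m, IsGenuine γ m → β m = β' m ∧ γ m = γ' m) (n : ℕ) :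
    jacobiMoment β γ n = jacobiMoment β' γ' n := by
  induction n using Nat.strong_induction_on generalizing β γ β' γ' with
  | _ n ih =>
    have h0 := h 0 (fun k hk => absurd hk k.not_lt_zero)
    match n, ih with
    | 0, _ => simp
    | 1, _ => simp [h0.1]
    | n + 2, ih =>
      rw [jacobiMoment_add_two, jacobiMoment_add_two, ih (n + 1) (by omega) h, h0.1, ← h0.2]
      by_cases hγ : γ 0 = 0
      · simp [hγ]
      · congr 2
        refine Finset.sum_congr rfl fun p hp => ?_
        have := Finset.HasAntidiagonal.mem_antidiagonal.1 hp
        rw [ih p.1 (by omega) h, ih p.2 (by omega) (β := shift β) (γ := shift γ)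
          (β' := shift β') (γ' := shift γ')]
        intro m hm
        refine h (m + 1) fun k hk => ?_
        rcases k with - | k
        · exact hγ
        · exact hm k (by omega)

/-- Subtracting the two continued fractions gives `(M - M') (1 - β₀ X - γ₀ X² N₁) = γ₀ X² M' (N₁ -
N₁')`. Apart from `X²` the cofactors are units, so removing the first parameters lowers the order of
the difference by two and divides its leading coefficient by `γ₀`. -/
theorem jacobiMoment_shift_sub {β' γ' : ℕ → ℝ} {N : ℕ} (hβ : β 0 = β' 0) (hγ : γ 0 = γ' 0)
    (hγ0 : γ' 0 ≠ 0) (h : ∀ n < N + 2, jacobiMoment β γ n = jacobiMoment β' γ' n) :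
    (∀ n < N, jacobiMoment (shift β) (shift γ) n = jacobiMoment (shift β') (shift γ') n) ∧
    jacobiMoment β γ (N + 2) - jacobiMoment β' γ' (N + 2) = γ' 0 *
      (jacobiMoment (shift β) (shift γ) N - jacobiMoment (shift β') (shift γ') N) := by
  obtain ⟨U, hU⟩ : PowerSeries.X ^ (N + 2) ∣ jacobiSeries β γ - jacobiSeries β' γ' := by
    rw [PowerSeries.X_pow_dvd_iff]
    intro n hn
    simp [jacobiSeries, h n hn]
  have h1 := jacobiSeries_eq β γ
  have h2 := jacobiSeries_eq β' γ'
  rw [hβ, hγ] at h1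
  set M := jacobiSeries β γ
  set M' := jacobiSeries β' γ' with hM'
  set N₁ := jacobiSeries (shift β) (shift γ) with hN₁
  set N₁' := jacobiSeries (shift β') (shift γ') with hN₁'
  have hX : (PowerSeries.X ^ 2 : PowerSeries ℝ) ≠ 0 := pow_ne_zero _ PowerSeries.X_ne_zero
  have e : PowerSeries.X ^ N * (U * (1 - PowerSeries.C (β' 0) * PowerSeries.X -
      PowerSeries.C (γ' 0) * PowerSeries.X ^ 2 * N₁))
      = PowerSeries.C (γ' 0) * M' * (N₁ - N₁') := by
    apply mul_left_cancel₀ hX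
    linear_combination h1 - h2 - (1 - PowerSeries.C (β' 0) * PowerSeries.X -
      PowerSeries.C (γ' 0) * PowerSeries.X ^ 2 * N₁) * hU
  have hunit : IsUnit (PowerSeries.C (γ' 0) * M') := by
    rw [PowerSeries.isUnit_iff_constantCoeff, map_mul, hM', constantCoeff_jacobiSeries]
    simpa using hγ0
  obtain ⟨W, hW⟩ : PowerSeries.X ^ N ∣ N₁ - N₁' :=
    (hunit.dvd_mul_left).1 (e ▸ Dvd.intro _ rfl)
  have e' : U * (1 - PowerSeries.C (β' 0) * PowerSeries.X -
      PowerSeries.C (γ' 0) * PowerSeries.X ^ 2 * N₁) = PowerSeries.C (γ' 0) * M' * W := by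
    apply mul_left_cancel₀ (pow_ne_zero N (PowerSeries.X_ne_zero (R := ℝ)))
    rw [e, hW]
    ring
  have e'' := congrArg PowerSeries.constantCoeff e'
  simp only [map_mul, map_sub, map_one, map_pow, PowerSeries.constantCoeff_X, hM',
    constantCoeff_jacobiSeries, PowerSeries.constantCoeff_C] at e''
  have hc : ∀ (n : ℕ) (Y : PowerSeries ℝ), PowerSeries.coeff n (PowerSeries.X ^ n * Y)
      = PowerSeries.constantCoeff Y := by
    intro n Y
    simpa using PowerSeries.coeff_X_pow_mul Y n 0
  constructor
  · intro n hn
    have := PowerSeries.X_pow_dvd_iff.1 ⟨W, hW⟩ n hn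
    simpa [hN₁, hN₁', jacobiSeries, sub_eq_zero] using this
  · have hl := congrArg (PowerSeries.coeff (N + 2)) hU
    have hr := congrArg (PowerSeries.coeff N) hW
    rw [hc] at hl hr
    simp only [map_sub, jacobiSeries, PowerSeries.coeff_mk, hN₁, hN₁', M, hM'] at hl hr
    rw [hl, hr]
    linear_combination e''

/-- If moments agree up to some order, then so do the Jacobi parameters, and the first difference of
the moments is proportional to the first difference of Jacobi parameters. -/
theorem jacobiMoment_first_difference (j : ℕ) {β γ β' γ' : ℕ → ℝ} (hγ : ∀ i < j, γ' i ≠ 0)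
    (h : ∀ n < 2 * j + 1, jacobiMoment β γ n = jacobiMoment β' γ' n) :
    (∀ i < j, β i = β' i ∧ γ i = γ' i) ∧
    jacobiMoment β γ (2 * j + 1) - jacobiMoment β' γ' (2 * j + 1)
      = (∏ i ∈ Finset.range j, γ' i) * (β j - β' j) ∧
    (β j = β' j → jacobiMoment β γ (2 * j + 2) - jacobiMoment β' γ' (2 * j + 2)
      = (∏ i ∈ Finset.range j, γ' i) * (γ j - γ' j)) := by
  induction j generalizing β γ β' γ' with
  | zero =>
    refine ⟨by simp, by simp, fun he => ?_⟩
    rw [mul_zero, zero_add, jacobiMoment_two, jacobiMoment_two, he]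
    simp
  | succ j ih =>
    have h1 : β 0 = β' 0 := by simpa using h 1 (by omega)
    have h2 : γ 0 = γ' 0 := by
      have := h 2 (by omega)
      rwa [jacobiMoment_two, jacobiMoment_two, h1, add_right_inj] at this
    have h0 := hγ 0 (Nat.succ_pos j)
    obtain ⟨ha, hb⟩ := jacobiMoment_shift_sub h1 h2 h0 (N := 2 * j + 1) fun n hn => h n (by omega)
    obtain ⟨ih1, ih2, ih3⟩ := ih (β := shift β) (γ := shift γ) (β' := shift β') (γ' := shift γ')
      (fun i hi => hγ (i + 1) (by omega)) ha
    have hprod : ∏ i ∈ Finset.range (j + 1), γ' i = γ' 0 * ∏ i ∈ Finset.range j, shift γ' i := by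
      rw [Finset.prod_range_succ', mul_comm]
      rfl
    refine ⟨fun i hi => ?_, ?_, fun he => ?_⟩
    · rcases i with - | i
      · exact ⟨h1, h2⟩
      · exact ih1 i (by omega)
    · rw [hprod, show 2 * (j + 1) + 1 = 2 * j + 1 + 2 by ring, hb, ih2]
      simp only [shift]
      ring
    · have he' : shift β j = shift β' j := he
      rw [he', sub_self, mul_zero] at ih2
      -- Equality of the `β`'s makes the moments of order `2 j + 3` agree too, so the first
      -- parameters can be removed one order further.
      obtain ⟨-, hb'⟩ := jacobiMoment_shift_sub h1 h2 h0 (N := 2 * j + 2) fun n hn => by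
        rcases Nat.lt_succ_iff_lt_or_eq.1 hn with hn | rfl
        · exact h n (by omega)
        · rw [← sub_eq_zero]
          exact hb.trans (by rw [ih2, mul_zero])
      rw [hprod, show 2 * (j + 1) + 2 = 2 * j + 2 + 2 by ring, hb', ih3 he]
      simp only [shift]
      ring

/-- The genuine Jacobi parameters are determined by the moments. -/
theorem eq_of_jacobiMoment_eq {β' γ' : ℕ → ℝ}
    (h : ∀ n, jacobiMoment β γ n = jacobiMoment β' γ' n) (m : ℕ) (hm : IsGenuine γ' m) :
    β m = β' m ∧ γ m = γ' m := by
  obtain ⟨-, h1, h2⟩ := jacobiMoment_first_difference m hm fun n _ => h n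
  have hp : ∏ i ∈ Finset.range m, γ' i ≠ 0 :=
    Finset.prod_ne_zero_iff.2 fun i hi => hm i (Finset.mem_range.1 hi)
  rw [h, sub_self, eq_comm, mul_eq_zero, or_iff_right hp, sub_eq_zero] at h1
  have h3 := h2 h1
  rw [h, sub_self, eq_comm, mul_eq_zero, or_iff_right hp, sub_eq_zero] at h3
  exact ⟨h1, h3⟩

end JacobiMoments

/-! ### Orthogonality of the polynomials under a linear functional -/

section Orthogonality

variable (β γ : ℕ → ℝ)

@[simp]
theorem jacobiPoly_zero : jacobiPoly β γ 0 = 1 := by rw [jacobiPoly]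

theorem X_mul_jacobiPoly_zero :
    X * jacobiPoly β γ 0 = jacobiPoly β γ 1 + C (β 0) * jacobiPoly β γ 0 := by
  simp [jacobiPoly]

theorem X_mul_jacobiPoly_succ (m : ℕ) : X * jacobiPoly β γ (m + 1) =
    jacobiPoly β γ (m + 2) + C (β (m + 1)) * jacobiPoly β γ (m + 1) +
      C (γ m) * jacobiPoly β γ m := by
  rw [jacobiPoly]
  ring

variable {β γ} {L : ℝ[X] →ₗ[ℝ] ℝ}

theorem functional_C_mul (L : ℝ[X] →ₗ[ℝ] ℝ) (a : ℝ) (p : ℝ[X]) : L (C a * p) = a * L p := by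
  rw [← smul_eq_C_mul, map_smul, smul_eq_mul]

theorem functional_pow_mul_jacobiPoly (h0 : L 1 = 1)
    (h : ∀ k, L (jacobiPoly β γ (k + 1)) = 0) (n k : ℕ) :
    L (X ^ n * jacobiPoly β γ k) = jacobiEntry β γ n k := by
  induction n generalizing k with
  | zero => rcases k with - | k <;> simp [jacobiEntry, h0, h]
  | succ n ih =>
    rcases k with - | k
    · rw [pow_succ, mul_assoc, X_mul_jacobiPoly_zero, mul_add, mul_left_comm, map_add,
        functional_C_mul, ih, ih, jacobiEntry]
    · rw [pow_succ, mul_assoc, X_mul_jacobiPoly_succ, mul_add, mul_add, mul_left_comm,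
        mul_left_comm (X ^ n) (C (γ k)), map_add, map_add, functional_C_mul, functional_C_mul, ih,
        ih, ih, jacobiEntry]

/-- The recurrence is solved for the polynomial of highest index. For `n = 0` this shows that the
later polynomials are annihilated by `L`, with no sign condition on `γ`. -/
theorem functional_pow_mul_jacobiPoly_of_moments (h : ∀ n, L (X ^ n) = jacobiMoment β γ n)
    (n k : ℕ) : L (X ^ n * jacobiPoly β γ k) = jacobiEntry β γ n k := by
  induction k using Nat.strong_induction_on generalizing n with
  | _ k ih =>
    match k, ih with
    | 0, _ => simpa [jacobiMoment] using h n
    | 1, ih =>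
      have e : X ^ n * jacobiPoly β γ 1
          = X ^ (n + 1) * jacobiPoly β γ 0 - C (β 0) * (X ^ n * jacobiPoly β γ 0) := by
        linear_combination (-X ^ n) * X_mul_jacobiPoly_zero β γ
      rw [e, map_sub, functional_C_mul, ih 0 (by omega), ih 0 (by omega), jacobiEntry]
      ring
    | k + 2, ih =>
      have e : X ^ n * jacobiPoly β γ (k + 2)
          = X ^ (n + 1) * jacobiPoly β γ (k + 1) - C (β (k + 1)) * (X ^ n * jacobiPoly β γ (k + 1))
            - C (γ k) * (X ^ n * jacobiPoly β γ k) := by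
        linear_combination (-X ^ n) * X_mul_jacobiPoly_succ β γ k
      rw [e, map_sub, map_sub, functional_C_mul, functional_C_mul, ih (k + 1) (by omega),
        ih (k + 1) (by omega), ih k (by omega), jacobiEntry]
      ring

/-- Orthogonality to constants suffices: the recurrence lowers `j`, and the factor `X` it produces
is moved to the other polynomial, where the recurrence absorbs it. -/
theorem functional_jacobiPoly_mul (h0 : L 1 = 1)
    (h : ∀ k, L (jacobiPoly β γ (k + 1)) = 0) (j i : ℕ) :
    L (jacobiPoly β γ i * jacobiPoly β γ j)
      = if i = j then ∏ k ∈ Finset.range i, γ k else 0 := by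
  induction j using Nat.strong_induction_on generalizing i with
  | _ j ih =>
    have base : ∀ i, L (jacobiPoly β γ i) = if i = 0 then 1 else 0 := by
      rintro (_ | i)
      · simp [h0]
      · simp [h]
    match j, ih with
    | 0, _ =>
      rw [jacobiPoly_zero, mul_one, base]
      split_ifs with hi <;> simp [hi]
    | 1, ih =>
      have e : jacobiPoly β γ i * jacobiPoly β γ 1
          = X * jacobiPoly β γ i - C (β 0) * jacobiPoly β γ i := by
        have := X_mul_jacobiPoly_zero β γ
        rw [jacobiPoly_zero] at this
        linear_combination (-jacobiPoly β γ i) * this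
      rw [e, map_sub, functional_C_mul]
      rcases i with - | i
      · rw [X_mul_jacobiPoly_zero, map_add, functional_C_mul, base, base]
        simp
      · rw [X_mul_jacobiPoly_succ, map_add, map_add, functional_C_mul, functional_C_mul, base, base,
          base]
        rcases i with - | i <;> simp
    | j + 2, ih =>
      have e : jacobiPoly β γ i * jacobiPoly β γ (j + 2)
          = X * jacobiPoly β γ i * jacobiPoly β γ (j + 1)
            - C (β (j + 1)) * (jacobiPoly β γ i * jacobiPoly β γ (j + 1))
            - C (γ j) * (jacobiPoly β γ i * jacobiPoly β γ j) := by
        linear_combination (-jacobiPoly β γ i) * X_mul_jacobiPoly_succ β γ j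
      rw [e, map_sub, map_sub, functional_C_mul, functional_C_mul, ih (j + 1) (by omega),
        ih j (by omega)]
      rcases i with - | i
      · rw [X_mul_jacobiPoly_zero, add_mul, mul_assoc, map_add, functional_C_mul,
          ih (j + 1) (by omega), ih (j + 1) (by omega)]
        rcases j with - | j <;> simp
      · rw [X_mul_jacobiPoly_succ, add_mul, add_mul, mul_assoc, mul_assoc, map_add, map_add,
          functional_C_mul, functional_C_mul, ih (j + 1) (by omega), ih (j + 1) (by omega),
          ih (j + 1) (by omega)]
        rcases lt_trichotomy i j with hlt | rfl | hlt
        · by_cases hij : i + 1 = j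
          · subst hij
            simp [Finset.prod_range_succ, show i ≠ i + 1 + 1 by omega]
            ring
          · simp [hij, show i + 2 ≠ j + 1 by omega, show i ≠ j by omega, show i ≠ j + 1 by omega]
        · simp
        · by_cases hij : i = j + 1
          · subst hij
            simp [Finset.prod_range_succ, show j + 1 + 1 ≠ j by omega]
            ring
          · simp [hij, show i ≠ j by omega, show i + 1 ≠ j by omega, show i + 2 ≠ j + 1 by omega]

end Orthogonality

/-! ### Measures with given Jacobi parameters and their moments -/

section MomentFunctional

variable {μ : Measure ℝ}

theorem IsMomentLaw.integrable_eval (h : IsMomentLaw μ) (p : ℝ[X]) :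
    Integrable (fun x => p.eval x) μ := by
  simp only [eval_eq_sum_range]
  exact integrable_finsetSum _ fun i _ => (h.integrable_pow i).const_mul _

/-- Integration of polynomials. -/
noncomputable def IsMomentLaw.functional (h : IsMomentLaw μ) : ℝ[X] →ₗ[ℝ] ℝ where
  toFun p := ∫ x, p.eval x ∂μ
  map_add' p q := by
    simp only [eval_add]
    exact integral_add (h.integrable_eval p) (h.integrable_eval q)
  map_smul' a p := by
    simp only [eval_smul, smul_eq_mul, RingHom.id_apply]
    exact integral_const_mul _ _

theorem IsMomentLaw.functional_apply (h : IsMomentLaw μ) (p : ℝ[X]) :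
    h.functional p = ∫ x, p.eval x ∂μ := rfl

theorem IsMomentLaw.functional_one (h : IsMomentLaw μ) : h.functional 1 = 1 := by
  have := h.isProbabilityMeasure
  simp [h.functional_apply]

theorem IsMomentLaw.moment_zero (h : IsMomentLaw μ) : moment μ 0 = 1 := by
  have := h.isProbabilityMeasure
  simp [moment]

theorem IsMomentLaw.functional_X_pow (h : IsMomentLaw μ) (n : ℕ) :
    h.functional (X ^ n) = moment μ n := by
  simp [h.functional_apply, moment]

/-- A sufficient condition for Jacobi parameters. -/
theorem IsMomentLaw.isJacobi_of_integral_eq_zero (h : IsMomentLaw μ) {β γ : ℕ → ℝ}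
    (hγ : ∀ m, 0 ≤ γ m) (h0 : ∀ k, ∫ x, (jacobiPoly β γ (k + 1)).eval x ∂μ = 0) :
    IsJacobi μ β γ := by
  refine ⟨hγ, fun i j hij => ?_⟩
  have := functional_jacobiPoly_mul (L := h.functional) h.functional_one h0 j i
  simpa [h.functional_apply, hij] using this

theorem IsMomentLaw.moment_of_isJacobi (h : IsMomentLaw μ) {β γ : ℕ → ℝ} (hJ : IsJacobi μ β γ)
    (n : ℕ) : moment μ n = jacobiMoment β γ n := by
  have := functional_pow_mul_jacobiPoly (L := h.functional) (β := β) (γ := γ) h.functional_one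
    (fun k => by simpa [h.functional_apply] using hJ.2 (k + 1) 0 (Nat.succ_ne_zero k)) n 0
  rw [jacobiPoly_zero, mul_one, h.functional_X_pow] at this
  exact this

theorem IsMomentLaw.integral_jacobiPoly (h : IsMomentLaw μ) {β γ : ℕ → ℝ}
    (hm : ∀ n, moment μ n = jacobiMoment β γ n) (k : ℕ) :
    ∫ x, (jacobiPoly β γ (k + 1)).eval x ∂μ = 0 := by
  have := functional_pow_mul_jacobiPoly_of_moments (L := h.functional) (β := β) (γ := γ)
    (fun n => (h.functional_X_pow n).trans (hm n)) 0 (k + 1)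
  rwa [pow_zero, one_mul] at this

theorem IsMomentLaw.isJacobi_of_moment (h : IsMomentLaw μ) {β γ : ℕ → ℝ} (hγ : ∀ m, 0 ≤ γ m)
    (hm : ∀ n, moment μ n = jacobiMoment β γ n) : IsJacobi μ β γ :=
  h.isJacobi_of_integral_eq_zero hγ (h.integral_jacobiPoly hm)

/-- If a measure has the moments with parameters `β`, `γ`, then `γ₀ γ₁ ≥ 0`. -/
theorem IsMomentLaw.gamma_mul_nonneg (h : IsMomentLaw μ) {β γ : ℕ → ℝ}
    (hm : ∀ n, moment μ n = jacobiMoment β γ n) : 0 ≤ γ 0 * γ 1 := by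
  -- `γ₀ γ₁` is the integral of the square of the second polynomial.
  have := functional_jacobiPoly_mul (L := h.functional) h.functional_one
    (h.integral_jacobiPoly hm) 2 2
  simp only [if_true, Finset.prod_range_succ, Finset.prod_range_zero, one_mul] at this
  rw [← this, h.functional_apply]
  refine integral_nonneg fun x => ?_
  rw [eval_mul]
  exact mul_self_nonneg _

end MomentFunctional

/-! ### Free cumulants of free Meixner distributions -/

section MeixnerCumulants

theorem exists_algHom_X (w : PowerSeries ℝ) (hw : PowerSeries.constantCoeff w = 0) :
    ∃ φ : PowerSeries ℝ →ₐ[ℝ] PowerSeries ℝ, φ PowerSeries.X = w := by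
  have h : PowerSeries.HasSubst w := PowerSeries.HasSubst.of_constantCoeff_zero' hw
  exact ⟨PowerSeries.substAlgHom h, PowerSeries.substAlgHom_X h⟩

theorem shift_headTail (u v : ℝ) : shift (headTail u v) = fun _ => v := rfl

theorem shift_const (v : ℝ) : shift (fun _ => v) = fun _ => v := rfl

/-- The free cumulants of free Meixner distributions. -/
def meixnerCumulant (β₀ γ₀ b c : ℝ) : ℕ → ℝ
  | 0 => 0
  | 1 => β₀
  | k + 2 => γ₀ * jacobiMoment (fun _ => b) (fun _ => c) k

/-- The core is `N = M · Q(X M)`, with `Q` the series for constant parameters `b`, `c`: both sides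
solve `Y = M (1 + b X Y + c X² Y²)`, which has only one power series solution. -/
theorem isFreeCumulantSeq_meixner (β₀ γ₀ b c : ℝ) :
    IsFreeCumulantSeq (jacobiSeries (headTail β₀ (b + β₀)) (headTail γ₀ (c + γ₀)))
      (meixnerCumulant β₀ γ₀ b c) := by
  have hM := jacobiSeries_eq (headTail β₀ (b + β₀)) (headTail γ₀ (c + γ₀))
  have hN := jacobiSeries_eq (fun _ => b + β₀) (fun _ => c + γ₀)
  have hQ := jacobiSeries_eq (fun _ => b) (fun _ => c)
  rw [shift_headTail, shift_headTail] at hM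
  rw [shift_const, shift_const] at hN hQ
  simp only [headTail, map_add] at hM hN hQ
  set M := jacobiSeries (headTail β₀ (b + β₀)) (headTail γ₀ (c + γ₀))
  set N := jacobiSeries (fun _ => b + β₀) (fun _ => c + γ₀)
  set q := jacobiMoment (fun _ => b) (fun _ => c) with hq
  obtain ⟨φ, hφ⟩ := exists_algHom_X (PowerSeries.X * M) (by simp)
  have hφC : ∀ a : ℝ, φ (PowerSeries.C a) = PowerSeries.C a := fun a => φ.commutes a
  -- `T k` is the `k`-th tail of `Q` evaluated at `X M`; the tails supply the chain `f` required by
  -- `IsFreeCumulantSeq`.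
  set T : ℕ → PowerSeries ℝ := fun k => φ (PowerSeries.mk fun i => q (k + i)) with hT
  have hTrec : ∀ k, T k = PowerSeries.C (q k) + PowerSeries.X * M * T (k + 1) := by
    intro k
    have e : (PowerSeries.mk fun i => q (k + i))
        = PowerSeries.C (q k) + PowerSeries.X * PowerSeries.mk fun i => q (k + 1 + i) := by
      ext n
      rcases n with - | n
      · rw [map_add, PowerSeries.coeff_zero_X_mul]
        simp
      · rw [map_add, PowerSeries.coeff_succ_X_mul, PowerSeries.coeff_C]
        simp [add_right_comm, ← add_assoc]
    simp only [hT]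
    rw [e, map_add, map_mul, hφ, hφC]
  have hT0 : T 0 = φ (jacobiSeries (fun _ => b) (fun _ => c)) := by
    simp only [hT, zero_add]
    rfl
  have hY := congrArg φ hQ
  simp only [map_add, map_mul, map_pow, map_one, hφ, hφC, ← hT0] at hY
  -- Cross-multiplying the two continued fractions eliminates `β₀` and `γ₀`.
  have hN' : N = M * (1 + PowerSeries.C b * PowerSeries.X * N +
      PowerSeries.C c * PowerSeries.X ^ 2 * N ^ 2) := by
    linear_combination M * hN - N * hM
  have hD : N - M * T 0 = 0 := by
    have hE : (N - M * T 0) * (1 - PowerSeries.X * (M * (PowerSeries.C b +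
        PowerSeries.C c * PowerSeries.X * (N + M * T 0)))) = 0 := by
      linear_combination hN' - M * hY
    refine (mul_eq_zero.1 hE).resolve_right fun h => ?_
    have := congrArg PowerSeries.constantCoeff h
    simp at this
  refine ⟨fun j => match j with
    | 0 => M - 1
    | k + 1 => PowerSeries.C γ₀ * (PowerSeries.X * M * T k), by ring, fun j => ?_⟩
  match j with
  | 0 =>
    simp only [meixnerCumulant]
    linear_combination hM + PowerSeries.C γ₀ * PowerSeries.X ^ 2 * M * hD
  | k + 1 =>
    simp only [meixnerCumulant, map_mul]
    linear_combination PowerSeries.C γ₀ * PowerSeries.X * M * hTrec k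

theorem freeCumulantOf_meixner (β₀ γ₀ b c : ℝ) (n : ℕ) (hn : 1 ≤ n) :
    freeCumulantOf (jacobiMoment (headTail β₀ (b + β₀)) (headTail γ₀ (c + γ₀))) n
      = meixnerCumulant β₀ γ₀ b c n :=
  (isFreeCumulantSeq_freeCumulantOf (jacobiMoment_zero _ _)).unique
    (isFreeCumulantSeq_meixner β₀ γ₀ b c) n hn

/-- Linearity in `(β₀, γ₀)` for fixed `b`, `c` is what keeps free powers inside the Meixner class.
-/
theorem meixnerCumulant_smul (t β₀ γ₀ b c : ℝ) (n : ℕ) :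
    meixnerCumulant (β₀ * t) (γ₀ * t) b c n = t * meixnerCumulant β₀ γ₀ b c n := by
  match n with
  | 0 => simp [meixnerCumulant]
  | 1 => simp only [meixnerCumulant]; ring
  | k + 2 => simp only [meixnerCumulant]; ring

end MeixnerCumulants

/-! ### Polynomial dependence forces constant parameters -/

section PolynomialParameters

/-- The equation holds at infinitely many points, hence as an identity of polynomials, and may be
evaluated at the root `-c / g` of the linear factor. -/
theorem eq_zero_of_mul_eval_eq {p : ℝ[X]} {c g δ : ℝ} (hg : g ≠ 0) {T : ℕ}
    (h : ∀ t : ℕ, T ≤ t → (c + g * t) * p.eval (t : ℝ) = δ) : δ = 0 := by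
  have hpoly : (C c + C g * X) * p - C δ = 0 := by
    refine Polynomial.eq_zero_of_infinite_isRoot _ ?_
    refine Set.Infinite.mono (s := (fun t : ℕ => (t : ℝ)) '' Set.Ici T) ?_
      ((Set.Ici_infinite T).image Nat.cast_injective.injOn)
    rintro _ ⟨t, ht, rfl⟩
    simp [IsRoot, h t ht]
  have := congrArg (Polynomial.eval (-c / g)) hpoly
  have e : c + g * (-c / g) = 0 := by
    field_simp
    ring
  simpa [e] using this

variable {μ : Measure ℝ}

/-- If the Jacobi parameters of the free powers depend polynomially on the exponent, then the
cumulants are those of a free Meixner distribution. -/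
theorem freeCumulant_eq_of_polynomial (hμ : IsMomentLaw μ) {β γ : ℕ → ℝ} (hJ : IsJacobi μ β γ)
    (hγ0 : γ 0 ≠ 0) {ν : ℕ → Measure ℝ} {B G : ℕ → ℕ → ℝ}
    (hν : ∀ t : ℕ, 1 ≤ t → IsFreePower μ t (ν t))
    (hνJ : ∀ t : ℕ, 1 ≤ t → IsJacobi (ν t) (B t) (G t))
    (hpoly : ∀ m : ℕ, ∃ p q : ℝ[X], ∀ t : ℕ, 1 ≤ t → IsGenuine (G t) m →
      B t m = p.eval (t : ℝ) ∧ G t m = q.eval (t : ℝ)) (N : ℕ) (hN : 1 ≤ N) :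
    freeCumulant μ N = meixnerCumulant (β 0) (γ 0) (β 1 - β 0) (γ 1 - γ 0) N := by
  set b := β 1 - β 0 with hb
  set c := γ 1 - γ 0 with hc
  induction N using Nat.strong_induction_on with
  | _ N ih =>
  -- the moments of the `t`-th power and of its model differ in order `N` first
  have main : ∀ (t : ℝ) (s : ℕ → ℝ), s 0 = 1 →
      (∀ n, 1 ≤ n → freeCumulantOf s n = t * freeCumulant μ n) →
      (∀ n < N, s n = jacobiMoment (headTail (β 0 * t) (b + β 0 * t))
        (headTail (γ 0 * t) (c + γ 0 * t)) n) ∧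
      s N - jacobiMoment (headTail (β 0 * t) (b + β 0 * t)) (headTail (γ 0 * t) (c + γ 0 * t)) N
        = t * (freeCumulant μ N - meixnerCumulant (β 0) (γ 0) b c N) := by
    intro t s hs0 hs
    have hlow : ∀ n, 1 ≤ n → n < N → freeCumulantOf s n = freeCumulantOf
        (jacobiMoment (headTail (β 0 * t) (b + β 0 * t)) (headTail (γ 0 * t) (c + γ 0 * t))) n := by
      intro n hn hnN
      rw [hs n hn, ih n hnN hn, freeCumulantOf_meixner _ _ _ _ n hn, meixnerCumulant_smul]
    refine ⟨eq_of_freeCumulantOf_eq (by simp [hs0]) hlow, ?_⟩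
    rw [sub_eq_freeCumulantOf_sub hlow, hs N hN, freeCumulantOf_meixner _ _ _ _ N hN,
      meixnerCumulant_smul]
    ring
  rw [← sub_eq_zero]
  set δ := freeCumulant μ N - meixnerCumulant (β 0) (γ 0) b c N
  -- the case of the exponent `1`
  have hone := main 1 (moment μ) hμ.moment_zero (fun n _ => by rw [one_mul]; rfl)
  simp only [mul_one, one_mul, hμ.moment_of_isJacobi hJ] at hone
  -- large exponents
  obtain ⟨T, hT⟩ : ∃ T : ℕ, 1 ≤ T ∧ ∀ t : ℕ, T ≤ t → 0 < c + γ 0 * t := by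
    have hpos : 0 < γ 0 := lt_of_le_of_ne (hJ.1 0) hγ0.symm
    obtain ⟨T, hT⟩ := exists_nat_gt (-c / γ 0)
    refine ⟨T + 1, by omega, fun t ht => ?_⟩
    rw [div_lt_iff₀ hpos] at hT
    have : (T : ℝ) ≤ t := by exact_mod_cast (by omega : T ≤ t)
    nlinarith
  have hlarge : ∀ t : ℕ, T ≤ t → 1 ≤ t ∧ γ 0 * t ≠ 0 := by
    intro t ht
    have h1 : 1 ≤ t := hT.1.trans ht
    exact ⟨h1, mul_ne_zero hγ0 (by exact_mod_cast (by omega : t ≠ 0))⟩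
  have hmod : ∀ t : ℕ, T ≤ t → ∀ i, headTail (γ 0 * t) (c + γ 0 * t) i ≠ 0 := by
    intro t ht i
    rcases i with - | i
    · exact (hlarge t ht).2
    · exact (hT.2 t ht).ne'
  have hpow : ∀ t : ℕ, 1 ≤ t → _ := fun t ht => main t (moment (ν t)) (hν t ht).1.moment_zero
    (hν t ht).2
  have hprod : ∀ (t : ℝ) (j : ℕ), ∏ i ∈ Finset.range (j + 2), headTail (γ 0 * t) (c + γ 0 * t) i
      = (γ 0 * t) * ((c + γ 0 * t) * (c + γ 0 * t) ^ j) := by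
    intro t j
    rw [Finset.prod_range_succ']
    simp only [headTail, Finset.prod_const, Finset.card_range]
    ring
  rcases Nat.even_or_odd' N with ⟨k, rfl | rfl⟩
  · -- `N = 2 (j + 1)`
    obtain ⟨j, rfl⟩ : ∃ j, k = j + 1 := ⟨k - 1, by omega⟩
    -- In even order the `j`-th `β`'s must agree first; this comes from the moments of order `2 j +
    -- 1 < N`. The disjunction admits zeros from index `j` on, as needed for `t = 1`, where `c + γ₀
    -- = γ₁` may vanish.
    have hbeta : ∀ t : ℝ, ∀ β' γ' : ℕ → ℝ, (∀ i, headTail (γ 0 * t) (c + γ 0 * t) i ≠ 0 ∨ j ≤ i) →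
        (∀ n < 2 * (j + 1), jacobiMoment β' γ' n = jacobiMoment (headTail (β 0 * t) (b + β 0 * t))
          (headTail (γ 0 * t) (c + γ 0 * t)) n) →
        (∀ i < j, γ' i = headTail (γ 0 * t) (c + γ 0 * t) i) ∧
        jacobiMoment β' γ' (2 * (j + 1)) - jacobiMoment (headTail (β 0 * t) (b + β 0 * t))
          (headTail (γ 0 * t) (c + γ 0 * t)) (2 * (j + 1))
          = (∏ i ∈ Finset.range j, headTail (γ 0 * t) (c + γ 0 * t) i) *
            (γ' j - headTail (γ 0 * t) (c + γ 0 * t) j) := by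
      intro t β' γ' hne hag
      have hne' : ∀ i < j, headTail (γ 0 * t) (c + γ 0 * t) i ≠ 0 := fun i hi =>
        (hne i).resolve_right (by omega)
      obtain ⟨h1, h2, h3⟩ := jacobiMoment_first_difference j hne' fun n hn => hag n (by omega)
      refine ⟨fun i hi => (h1 i hi).2, h3 ?_⟩
      rw [hag _ (by omega), sub_self, eq_comm, mul_eq_zero, or_iff_right, sub_eq_zero] at h2
      · exact h2
      · exact Finset.prod_ne_zero_iff.2 fun i hi => hne' i (Finset.mem_range.1 hi)
    match j with
    -- Indices `0` and `1` are settled by the exponent `1`, since the model was built from `β₀`,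
    -- `β₁`, `γ₀`, `γ₁`.
    | 0 =>
      have := (hbeta 1 β γ (fun i => Or.inr (Nat.zero_le i)) (by simpa using hone.1)).2
      simp only [mul_one, hone.2] at this
      simpa [headTail] using this
    | 1 =>
      have := (hbeta 1 β γ (fun i => by
        rcases i with - | i
        · exact Or.inl (by simpa [headTail] using hγ0)
        · exact Or.inr (by omega)) (by simpa using hone.1)).2
      simp only [mul_one, hone.2] at this
      simpa [headTail, hc] using this
    | j + 2 =>
      obtain ⟨p, q, hpq⟩ := hpoly (j + 2)
      -- The polynomial comes from `t δ = γ₀ t (c + γ₀ t)^(j + 1) (q(t) - (c + γ₀ t))` after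
      -- cancelling `t` and setting aside one factor `c + γ₀ t`.
      refine eq_zero_of_mul_eval_eq (p := C (γ 0) * (C c + C (γ 0) * X) ^ j * (q - (C c + C (γ 0) * X)))
        (c := c) (g := γ 0) hγ0 (T := T) fun t ht => ?_
      have h1 := (hlarge t ht).1
      have hm := hpow t h1
      simp only [(hν t h1).1.moment_of_isJacobi (hνJ t h1)] at hm
      obtain ⟨ha, hd⟩ := hbeta t (B t) (G t) (fun i => Or.inl (hmod t ht i)) hm.1
      -- The earlier `γ`'s equal those of the model, which do not vanish for `t ≥ T`, so index `j +
      -- 2` is genuine.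
      have hq := (hpq t h1 fun k hk => by rw [ha k hk]; exact hmod t ht k).2
      rw [hm.2, hprod, hq] at hd
      have ht0 : (t : ℝ) ≠ 0 := right_ne_zero_of_mul (hlarge t ht).2
      simp only [headTail] at hd
      simp only [eval_mul, eval_pow, eval_add, eval_sub, eval_C, eval_X]
      apply mul_left_cancel₀ ht0
      linear_combination -hd
  · -- `N = 2 k + 1`
    match k with
    | 0 =>
      have := (jacobiMoment_first_difference 0 (by simp) hone.1).2.1
      rw [hone.2] at this
      simpa [headTail] using this
    | 1 =>
      have := (jacobiMoment_first_difference 1 (by simpa [headTail] using hγ0) hone.1).2.1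
      rw [hone.2] at this
      simpa [headTail, hb] using this
    | j + 2 =>
      obtain ⟨p, q, hpq⟩ := hpoly (j + 2)
      refine eq_zero_of_mul_eval_eq
        (p := C (γ 0) * (C c + C (γ 0) * X) ^ j * (p - (C b + C (β 0) * X)))
        (c := c) (g := γ 0) hγ0 (T := T) fun t ht => ?_
      have h1 := (hlarge t ht).1
      have hm := hpow t h1
      simp only [(hν t h1).1.moment_of_isJacobi (hνJ t h1)] at hm
      obtain ⟨ha, hd, -⟩ := jacobiMoment_first_difference (j + 2) (fun i _ => hmod t ht i) hm.1
      have hp := (hpq t h1 fun k hk => by rw [(ha k hk).2]; exact hmod t ht k).1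
      rw [hm.2, hprod, hp] at hd
      have ht0 : (t : ℝ) ≠ 0 := right_ne_zero_of_mul (hlarge t ht).2
      simp only [headTail] at hd
      simp only [eval_mul, eval_pow, eval_add, eval_sub, eval_C, eval_X]
      apply mul_left_cancel₀ ht0
      linear_combination -hd

/-- If the Jacobi parameters of the free powers depend polynomially on the exponent, then they are
constant from index `1` on. -/
theorem constantFromOne_of_polynomial (hμ : IsMomentLaw μ) {β γ : ℕ → ℝ} (hJ : IsJacobi μ β γ)
    {ν : ℕ → Measure ℝ} {B G : ℕ → ℕ → ℝ}
    (hν : ∀ t : ℕ, 1 ≤ t → IsFreePower μ t (ν t))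
    (hνJ : ∀ t : ℕ, 1 ≤ t → IsJacobi (ν t) (B t) (G t))
    (hpoly : ∀ m : ℕ, ∃ p q : ℝ[X], ∀ t : ℕ, 1 ≤ t → IsGenuine (G t) m →
      B t m = p.eval (t : ℝ) ∧ G t m = q.eval (t : ℝ)) : ConstantFromOne β γ := by
  intro m hm hgen
  -- If `γ₀ = 0`, no index `m ≥ 1` is genuine and nothing is claimed.
  have hγ0 : γ 0 ≠ 0 := hgen 0 hm
  have hcum := freeCumulant_eq_of_polynomial hμ hJ hγ0 hν hνJ hpoly
  have hmom : ∀ n, jacobiMoment (headTail (β 0) (β 1)) (headTail (γ 0) (γ 1)) n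
      = jacobiMoment β γ n := by
    intro n
    rw [← hμ.moment_of_isJacobi hJ]
    refine eq_of_freeCumulantOf_eq (by simp [hμ.moment_zero]) (N := n + 1) ?_ n n.lt_succ_self
    intro k hk _
    have := freeCumulantOf_meixner (β 0) (γ 0) (β 1 - β 0) (γ 1 - γ 0) k hk
    rw [sub_add_cancel, sub_add_cancel] at this
    rw [this, ← hcum k hk]
    rfl
  obtain ⟨h1, h2⟩ := eq_of_jacobiMoment_eq hmom m hgen
  obtain ⟨k, rfl⟩ := Nat.exists_eq_add_of_le' hm
  exact ⟨h1.symm, h2.symm⟩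

theorem ConstantFromOne.jacobiMoment_eq {β γ : ℕ → ℝ} (h : ConstantFromOne β γ) (n : ℕ) :
    jacobiMoment β γ n = jacobiMoment (headTail (β 0) (β 1)) (headTail (γ 0) (γ 1)) n := by
  refine jacobiMoment_congr (fun m hm => ?_) n
  rcases m with - | m
  · exact ⟨rfl, rfl⟩
  · exact h (m + 1) (by omega) hm

theorem ConstantFromOne.isFreeMeixner (hμ : IsMomentLaw μ) {β γ : ℕ → ℝ} (hJ : IsJacobi μ β γ)
    (h : ConstantFromOne β γ) : IsFreeMeixner μ := by
  refine ⟨hμ, β 0, γ 0, β 1 - β 0, γ 1 - γ 0, hJ.1 0, by simpa using hJ.1 1, ?_⟩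
  rw [sub_add_cancel, sub_add_cancel]
  refine hμ.isJacobi_of_moment (fun m => ?_) fun n =>
    (hμ.moment_of_isJacobi hJ n).trans (h.jacobiMoment_eq n)
  rcases m with - | m
  · exact hJ.1 0
  · exact hJ.1 1

theorem ConstantFromOne.freeCumulant_eq (hμ : IsMomentLaw μ) {β γ : ℕ → ℝ} (hJ : IsJacobi μ β γ)
    (h : ConstantFromOne β γ) (n : ℕ) (hn : 1 ≤ n) :
    freeCumulant μ n = meixnerCumulant (β 0) (γ 0) (β 1 - β 0) (γ 1 - γ 0) n := by
  have hm : moment μ = jacobiMoment (headTail (β 0) (β 1)) (headTail (γ 0) (γ 1)) :=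
    funext fun n => (hμ.moment_of_isJacobi hJ n).trans (h.jacobiMoment_eq n)
  have := freeCumulantOf_meixner (β 0) (γ 0) (β 1 - β 0) (γ 1 - γ 0) n hn
  rw [sub_add_cancel, sub_add_cancel] at this
  rw [freeCumulant, hm, this]

end PolynomialParameters

/-! ### Spectral measures of bounded self-adjoint operators -/

section SpectralMeasure

open CompactlySupported

variable {H : Type*} [NormedAddCommGroup H] [InnerProductSpace ℂ H] [CompleteSpace H]

/-- The positive functional `f ↦ ⟨e, f(T) e⟩`. -/
noncomputable def vectorState {T : H →L[ℂ] H} (hT : IsSelfAdjoint T) (e : H) :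
    C_c(spectrum ℝ T, ℝ) →ₚ[ℝ] ℝ :=
  PositiveLinearMap.mk₀
    { toFun := fun f => (inner ℂ e (cfcHom hT (f : C(spectrum ℝ T, ℝ)) e)).re
      map_add' := by
        intro f g
        have : ((f + g : C_c(spectrum ℝ T, ℝ)) : C(spectrum ℝ T, ℝ))
          = (f : C(spectrum ℝ T, ℝ)) + (g : C(spectrum ℝ T, ℝ)) := rfl
        rw [this, map_add, add_apply, inner_add_right, Complex.add_re]
      map_smul' := by
        intro a f
        have : ((a • f : C_c(spectrum ℝ T, ℝ)) : C(spectrum ℝ T, ℝ))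
          = a • (f : C(spectrum ℝ T, ℝ)) := rfl
        rw [this, map_smul, smul_apply, inner_smul_right_eq_smul]
        simp }
    (by
      intro f hf
      -- With `f = (√f)²` the value of the functional is `‖√f(T) e‖²`.
      have hsq : (f : C(spectrum ℝ T, ℝ))
          = star (⟨fun x => Real.sqrt (f x), by fun_prop⟩ : C(spectrum ℝ T, ℝ)) *
            (⟨fun x => Real.sqrt (f x), by fun_prop⟩ : C(spectrum ℝ T, ℝ)) := by
        ext x
        simpa using (Real.mul_self_sqrt (hf x)).symm
      simp only [LinearMap.coe_mk, AddHom.coe_mk]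
      rw [hsq, map_mul, map_star, mul_apply_eq_comp, ContinuousLinearMap.star_eq_adjoint,
        ContinuousLinearMap.adjoint_inner_right, inner_self_eq_norm_sq_to_K]
      norm_cast
      exact sq_nonneg _)

/-- The spectral measure of a bounded self-adjoint operator at a unit vector. -/
theorem exists_spectralMeasure {T : H →L[ℂ] H} (hT : IsSelfAdjoint T) {e : H} (he : ‖e‖ = 1) :
    ∃ μ : Measure ℝ, IsProbabilityMeasure μ ∧ (∃ R : ℝ, ∀ᵐ x ∂μ, |x| ≤ R) ∧
      ∀ p : ℝ[X], ∫ x, p.eval x ∂μ = (inner ℂ e (aeval T p e)).re := by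
  set m := RealRMK.rieszMeasure (vectorState hT e) with hm
  have hint : ∀ p : ℝ[X], ∫ x : spectrum ℝ T, p.eval (x : ℝ) ∂m
      = (inner ℂ e (aeval T p e)).re := by
    intro p
    set f : C(spectrum ℝ T, ℝ) := ⟨fun x => p.eval (x : ℝ), by fun_prop⟩ with hf
    have h := RealRMK.integral_rieszMeasure (vectorState hT e)
      (CompactlySupportedContinuousMap.continuousMapEquiv f)
    have h2 : cfcHom hT f = aeval T p := by
      have : f = aeval ((ContinuousMap.id ℝ).restrict (spectrum ℝ T)) p := by
        ext x
        simp only [hf, ContinuousMap.coe_mk]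
        rw [← ContinuousMap.evalAlgHom_apply (R := ℝ) ℝ, ← Polynomial.aeval_algHom_apply]
        simp [aeval_def, eval₂_eq_eval_map]
      rw [this, ← Polynomial.aeval_algHom_apply, cfcHom_id]
    rw [← h2]
    exact h
  have hfin : IsFiniteMeasure m := by
    refine ⟨?_⟩
    have : IsFiniteMeasureOnCompacts m := inferInstance
    exact isCompact_univ.measure_lt_top
  have hprob : IsProbabilityMeasure m := by
    refine ⟨?_⟩
    have := hint 1
    simp only [eval_one, integral_const, smul_eq_mul, mul_one, map_one,
      one_apply_eq_self, inner_self_eq_norm_sq_to_K, he] at this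
    rw [Measure.real] at this
    rw [← ENNReal.toReal_eq_one_iff]
    simpa using this
  refine ⟨m.map Subtype.val, Measure.isProbabilityMeasure_map (by fun_prop), ?_, fun p => ?_⟩
  · refine ⟨‖T‖ * ‖(1 : H →L[ℂ] H)‖, ?_⟩
    rw [ae_map_iff (by fun_prop) (measurableSet_le (by fun_prop) (by fun_prop))]
    refine Eventually.of_forall fun x => ?_
    exact spectrum.norm_le_norm_mul_of_mem x.2
  · rw [integral_map (by fun_prop) (by fun_prop)]
    exact hint p

end SpectralMeasure

theorem isMomentLaw_of_bounded {μ : Measure ℝ} [IsProbabilityMeasure μ] {R : ℝ}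
    (hR : ∀ᵐ x ∂μ, |x| ≤ R) : IsMomentLaw μ := by
  refine ⟨inferInstance, fun n => ?_⟩
  refine Integrable.of_bound (by fun_prop) (R ^ n) ?_
  filter_upwards [hR] with x hx
  rw [norm_pow]
  exact pow_le_pow_left₀ (norm_nonneg _) hx n

/-! ### Existence by means of Jacobi operators -/

section JacobiOperator

/-- The unilateral shift. -/
theorem exists_isometry_shift : ∃ (S : lp (fun _ : ℕ => ℂ) 2 →L[ℂ] lp (fun _ : ℕ => ℂ) 2)
    (e : ℕ → lp (fun _ : ℕ => ℂ) 2), Orthonormal ℂ e ∧ (∀ k, S (e k) = e (k + 1)) ∧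
      star S (e 0) = 0 ∧ ∀ k, star S (e (k + 1)) = e k := by
  set e : ℕ → lp (fun _ : ℕ => ℂ) 2 := fun k => lp.single 2 k (1 : ℂ) with he
  have horth : Orthonormal ℂ e := by
    rw [orthonormal_iff_ite]
    intro i j
    rw [he]
    simp only
    rw [lp.inner_single_left, lp.single_apply]
    by_cases h : i = j
    · subst h
      simp
    · simp [h]
  have hV := (horth.comp (fun k => k + 1) (add_left_injective 1)).orthogonalFamily
  set S := hV.linearIsometry with hS
  have hSe : ∀ k, S (e k) = e (k + 1) := by
    intro k
    refine (hV.linearIsometry_apply_single (i := k) (1 : ℂ)).trans ?_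
    simp
  refine ⟨S.toContinuousLinearMap, e, horth, hSe, ?_, fun k => ?_⟩
  · ext k
    have h1 : inner ℂ (e k) (star S.toContinuousLinearMap (e 0)) = 0 := by
      rw [ContinuousLinearMap.star_eq_adjoint, ContinuousLinearMap.adjoint_inner_right]
      simp only [LinearIsometry.coe_toContinuousLinearMap, hSe]
      exact horth.2 (Nat.succ_ne_zero k)
    rw [he] at h1
    simp only at h1
    rw [lp.inner_single_left] at h1
    simpa using h1
  · rw [← hSe k, ContinuousLinearMap.star_eq_adjoint]
    refine ext_inner_left ℂ fun v => ?_
    rw [ContinuousLinearMap.adjoint_inner_right]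
    exact S.inner_map_map v (e k)

variable {H : Type*} [NormedAddCommGroup H] [InnerProductSpace ℂ H]

/-- The Jacobi operator whose coefficients are constant from index `1` on. -/
theorem exists_jacobiOperator [CompleteSpace H] {S : H →L[ℂ] H} {e : ℕ → H}
    (hS : ∀ k, S (e k) = e (k + 1)) (hS0 : star S (e 0) = 0) (hS1 : ∀ k, star S (e (k + 1)) = e k)
    (β₀ β₁ s₀ s₁ : ℝ) :
    ∃ T : H →L[ℂ] H, IsSelfAdjoint T ∧ T (e 0) = β₀ • e 0 + s₀ • e 1 ∧
      ∀ k, T (e (k + 1)) = headTail β₀ β₁ (k + 1) • e (k + 1) + headTail s₀ s₁ (k + 1) • e (k + 2)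
        + headTail s₀ s₁ k • e k := by
  -- `P` fixes `e 0` and kills every other `e k`. It corrects the first diagonal and off-diagonal
  -- entries of the constant operator `β₁ + s₁ (S + S*)`.
  set P := 1 - S * star S with hP
  have hPsa : star P = P := by simp [hP]
  have hP0 : P (e 0) = e 0 := by simp [hP, hS0]
  have hP1 : ∀ k, P (e (k + 1)) = 0 := fun k => by simp [hP, hS1, hS]
  refine ⟨β₁ • (1 : H →L[ℂ] H) + s₁ • (S + star S)
    + (β₀ - β₁) • P + (s₀ - s₁) • (S * P + P * star S), ?_, ?_, fun k => ?_⟩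
  · rw [isSelfAdjoint_iff]
    simp only [star_add, star_smul, star_trivial, star_one, star_star, star_mul, hPsa]
    rw [add_comm (star S) S, add_comm (P * star S)]
  · simp only [add_apply, smul_apply,
      one_apply_eq_self, mul_apply_eq_comp, hS, hS0, hP0, map_zero]
    module
  · rcases k with - | k
    · simp only [add_apply, smul_apply,
        one_apply_eq_self, mul_apply_eq_comp, hS, hS1, hP0, hP1, map_zero,
        headTail]
      module
    · simp only [add_apply, smul_apply,
        one_apply_eq_self, mul_apply_eq_comp, hS, hS1, hP1, map_zero,
        headTail]
      module

/-- Rescaled by `∏ s_i`, the symmetric recurrence of `T` with off-diagonal entries `s_k` becomes the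
monic one with `γ_k = s_k²`. Hence `P_{k+1}(T) e_0` is orthogonal to `e_0`. Vanishing `s_k` do no
harm. -/
theorem aeval_jacobiPoly_apply {T : H →L[ℂ] H} {e : ℕ → H} {β γ s : ℕ → ℝ}
    (hs : ∀ k, s k ^ 2 = γ k) (h0 : T (e 0) = β 0 • e 0 + s 0 • e 1)
    (h : ∀ k, T (e (k + 1)) = β (k + 1) • e (k + 1) + s (k + 1) • e (k + 2) + s k • e k) (k : ℕ) :
    aeval T (jacobiPoly β γ k) (e 0) = (∏ i ∈ Finset.range k, s i) • e k := by
  have hC : ∀ (a : ℝ) (v : H), algebraMap ℝ (H →L[ℂ] H) a v = a • v := by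
    intro a v
    rw [Algebra.algebraMap_eq_smul_one]
    simp
  induction k using Nat.strong_induction_on with
  | _ k ih =>
    match k, ih with
    | 0, _ => simp
    | 1, _ =>
      simp [jacobiPoly, h0, hC]
    | k + 2, ih =>
      rw [jacobiPoly, map_sub, map_mul, map_mul, sub_apply,
        mul_apply_eq_comp, mul_apply_eq_comp, ih (k + 1) (by omega),
        ih k (by omega)]
      simp only [map_sub, aeval_X, aeval_C, sub_apply, hC,
        ContinuousLinearMap.map_smul_of_tower, h, Finset.prod_range_succ, ← hs k]
      module

theorem exists_isJacobi_of_shift [CompleteSpace H] {S : H →L[ℂ] H} {e : ℕ → H}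
    (he : Orthonormal ℂ e) (hS : ∀ k, S (e k) = e (k + 1)) (hS0 : star S (e 0) = 0)
    (hS1 : ∀ k, star S (e (k + 1)) = e k) (β₀ β₁ : ℝ) {γ₀ γ₁ : ℝ} (h₀ : 0 ≤ γ₀) (h₁ : 0 ≤ γ₁) :
    ∃ μ : Measure ℝ, IsMomentLaw μ ∧ (∃ R : ℝ, ∀ᵐ x ∂μ, |x| ≤ R) ∧
      IsJacobi μ (headTail β₀ β₁) (headTail γ₀ γ₁) := by
  obtain ⟨T, hT, hTe0, hTe⟩ :=
    exists_jacobiOperator hS hS0 hS1 β₀ β₁ (Real.sqrt γ₀) (Real.sqrt γ₁)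
  obtain ⟨μ, hμ, ⟨R, hR⟩, hint⟩ := exists_spectralMeasure hT (he.1 0)
  have hlaw := isMomentLaw_of_bounded hR
  refine ⟨μ, hlaw, ⟨R, hR⟩, hlaw.isJacobi_of_integral_eq_zero ?_ fun k => ?_⟩
  · rintro (_ | m)
    · exact h₀
    · exact h₁
  · rw [hint, aeval_jacobiPoly_apply (s := headTail (Real.sqrt γ₀) (Real.sqrt γ₁)) ?_ hTe0 hTe,
      inner_smul_right_eq_smul, he.2 (Nat.succ_ne_zero k).symm]
    · simp
    · rintro (_ | m)
      · exact Real.sq_sqrt h₀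
      · exact Real.sq_sqrt h₁

/-- Measures with Jacobi parameters that are constant from index `1` on exist. -/
theorem exists_isJacobi_headTail (β₀ β₁ : ℝ) {γ₀ γ₁ : ℝ} (h₀ : 0 ≤ γ₀) (h₁ : 0 ≤ γ₁) :
    ∃ μ : Measure ℝ, IsMomentLaw μ ∧ (∃ R : ℝ, ∀ᵐ x ∂μ, |x| ≤ R) ∧
      IsJacobi μ (headTail β₀ β₁) (headTail γ₀ γ₁) := by
  obtain ⟨S, e, he, hS, hS0, hS1⟩ := exists_isometry_shift
  exact exists_isJacobi_of_shift he hS hS0 hS1 β₀ β₁ h₀ h₁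

end JacobiOperator

/-! ### Determinacy of the moment problem -/

section Determinacy

/-- From `|y| ≤ 1 + y²` the bound on even moments controls all absolute moments, so the exponential
series may be integrated term by term. The hypothesis involves moments only and thus passes to any
measure with the same moments, whatever its support. -/
theorem IsMomentLaw.charFun_eq {ν : Measure ℝ} (h : IsMomentLaw ν) {R : ℝ}
    (hR : ∀ n, moment ν (2 * n) ≤ R ^ (2 * n)) (t : ℝ) :
    charFun ν t
      = ∑' n : ℕ, (t * Complex.I) ^ n / (n.factorial : ℂ) * (moment ν n : ℂ) := by
  have := h.isProbabilityMeasure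
  have hint : ∀ n : ℕ, Integrable (fun x : ℝ =>
      (t * Complex.I) ^ n / (n.factorial : ℂ) * ((x ^ n : ℝ) : ℂ)) ν :=
    fun n => ((h.integrable_pow n).ofReal).const_mul _
  have hbound : ∀ n : ℕ, ∫ x : ℝ, ‖(t * Complex.I) ^ n / (n.factorial : ℂ) * ((x ^ n : ℝ) : ℂ)‖ ∂ν
      ≤ |t| ^ n / n.factorial + (|t| * R ^ 2) ^ n / n.factorial := by
    intro n
    have h1 : ∀ x : ℝ, ‖(t * Complex.I) ^ n / (n.factorial : ℂ) * ((x ^ n : ℝ) : ℂ)‖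
        = |t| ^ n / n.factorial * ‖x ^ n‖ := by
      intro x
      rw [norm_mul, norm_div, norm_pow, norm_mul, Complex.norm_I, mul_one, Complex.norm_real,
        Complex.norm_real, Complex.norm_natCast, Real.norm_eq_abs]
    simp only [h1]
    rw [integral_const_mul]
    have h2 : ∫ x : ℝ, ‖x ^ n‖ ∂ν ≤ 1 + R ^ (2 * n) := by
      calc ∫ x : ℝ, ‖x ^ n‖ ∂ν ≤ ∫ x : ℝ, (1 + x ^ (2 * n)) ∂ν := by
            refine integral_mono (h.integrable_pow n).norm
              ((integrable_const _).add (h.integrable_pow _)) fun x => ?_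
            have e : x ^ (2 * n) = ‖x ^ n‖ ^ 2 := by
              rw [Real.norm_eq_abs, sq_abs]
              ring
            simp only [e]
            nlinarith [sq_nonneg (‖x ^ n‖ - 1), norm_nonneg (x ^ n)]
        _ = 1 + moment ν (2 * n) := by
            rw [integral_add (integrable_const _) (h.integrable_pow _)]
            simp [moment]
        _ ≤ _ := by
            have := hR n
            linarith
    calc |t| ^ n / n.factorial * ∫ x : ℝ, ‖x ^ n‖ ∂ν
        ≤ |t| ^ n / n.factorial * (1 + R ^ (2 * n)) := by gcongr
      _ = _ := by
        rw [mul_pow, ← pow_mul]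
        ring
  have hsum : Summable fun n : ℕ =>
      ∫ x : ℝ, ‖(t * Complex.I) ^ n / (n.factorial : ℂ) * ((x ^ n : ℝ) : ℂ)‖ ∂ν :=
    Summable.of_nonneg_of_le (fun n => integral_nonneg fun x => norm_nonneg _) hbound
      ((Real.summable_pow_div_factorial _).add (Real.summable_pow_div_factorial _))
  have key := hasSum_integral_of_summable_integral_norm hint hsum
  rw [charFun_apply_real]
  have e1 : ∀ x : ℝ, ∑' n : ℕ, (t * Complex.I) ^ n / (n.factorial : ℂ) * ((x ^ n : ℝ) : ℂ)
      = Complex.exp (t * x * Complex.I) := by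
    intro x
    rw [Complex.exp_eq_exp_ℂ, NormedSpace.exp_eq_tsum_div]
    refine tsum_congr fun n => ?_
    push_cast
    rw [mul_right_comm, mul_pow _ (x : ℂ)]
    ring
  simp only [e1] at key
  rw [← key.tsum_eq]
  refine tsum_congr fun n => ?_
  rw [integral_const_mul, integral_complex_ofReal]
  rfl

/-- Compactly supported measures are determined by their moments. -/
theorem eq_of_moment_eq {μ ν : Measure ℝ} (hμ : IsMomentLaw μ) (hν : IsMomentLaw ν) {R : ℝ}
    (hR : ∀ᵐ x ∂μ, |x| ≤ R) (h : ∀ n, moment ν n = moment μ n) : ν = μ := by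
  have := hμ.isProbabilityMeasure
  have := hν.isProbabilityMeasure
  have hbound : ∀ n, moment μ (2 * n) ≤ R ^ (2 * n) := by
    intro n
    calc moment μ (2 * n) ≤ ∫ _, R ^ (2 * n) ∂μ := by
          refine integral_mono_ae (hμ.integrable_pow _) (integrable_const _) ?_
          filter_upwards [hR] with x hx
          rw [← (even_two_mul n).pow_abs]
          exact pow_le_pow_left₀ (abs_nonneg x) hx _
      _ = R ^ (2 * n) := by simp
  refine Measure.ext_of_charFun (funext fun t => ?_)
  rw [hμ.charFun_eq hbound, hν.charFun_eq (fun n => (h _).trans_le (hbound n))]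
  simp only [h]

end Determinacy

/-! ### Moment generating functions of compactly supported measures -/

section CauchyTransform

/-- The moment series of a compactly supported measure. -/
theorem hasSum_moment {ρ : Measure ℝ} [IsProbabilityMeasure ρ] {R : ℝ} (hR0 : 0 < R)
    (hR : ∀ᵐ x ∂ρ, |x| ≤ R) {z : ℂ} (hz : ‖z‖ < R⁻¹) :
    Integrable (fun x : ℝ => (1 : ℂ) / (1 - z * (x : ℂ))) ρ ∧
    HasSum (fun k : ℕ => (moment ρ k : ℂ) * z ^ k) (∫ x : ℝ, (1 : ℂ) / (1 - z * (x : ℂ)) ∂ρ) := by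
  have hlaw := isMomentLaw_of_bounded hR
  have hq : ‖z‖ * R < 1 := by rwa [← lt_inv_mul_iff₀' hR0, mul_one]
  have hle : ∀ᵐ x : ℝ ∂ρ, ‖z * (x : ℂ)‖ ≤ ‖z‖ * R := by
    filter_upwards [hR] with x hx
    rw [norm_mul, Complex.norm_real]
    exact mul_le_mul_of_nonneg_left hx (norm_nonneg z)
  constructor
  · refine Integrable.of_bound (Measurable.aestronglyMeasurable (by fun_prop))
      (1 / (1 - ‖z‖ * R)) ?_
    filter_upwards [hle] with x hx
    rw [norm_div, norm_one]
    refine one_div_le_one_div_of_le (by linarith) ?_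
    have := norm_sub_norm_le (1 : ℂ) (z * x)
    rw [norm_one] at this
    linarith
  · have hint : ∀ k : ℕ, Integrable (fun x : ℝ => z ^ k * ((x ^ k : ℝ) : ℂ)) ρ :=
      fun k => ((hlaw.integrable_pow k).ofReal).const_mul _
    have hbound : ∀ k : ℕ, ∫ x : ℝ, ‖z ^ k * ((x ^ k : ℝ) : ℂ)‖ ∂ρ ≤ (‖z‖ * R) ^ k := by
      intro k
      calc ∫ x : ℝ, ‖z ^ k * ((x ^ k : ℝ) : ℂ)‖ ∂ρ ≤ ∫ _, (‖z‖ * R) ^ k ∂ρ := by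
            refine integral_mono_ae (hint k).norm (integrable_const _) ?_
            filter_upwards [hle] with x hx
            rw [Complex.ofReal_pow, ← mul_pow, norm_pow]
            exact pow_le_pow_left₀ (norm_nonneg _) hx k
        _ = _ := by simp
    have hsum : Summable fun k : ℕ => ∫ x : ℝ, ‖z ^ k * ((x ^ k : ℝ) : ℂ)‖ ∂ρ :=
      Summable.of_nonneg_of_le (fun n => integral_nonneg fun x => norm_nonneg _) hbound
        (summable_geometric_of_lt_one (by positivity) hq)
    have key := hasSum_integral_of_summable_integral_norm hint hsum
    have e1 : ∫ x : ℝ, ∑' k : ℕ, z ^ k * ((x ^ k : ℝ) : ℂ) ∂ρ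
        = ∫ x : ℝ, (1 : ℂ) / (1 - z * (x : ℂ)) ∂ρ := by
      refine integral_congr_ae ?_
      filter_upwards [hle] with x hx
      rw [one_div, ← tsum_geometric_of_norm_lt_one (hx.trans_lt hq)]
      refine tsum_congr fun k => ?_
      rw [Complex.ofReal_pow, mul_pow]
    have e2 : ∀ k : ℕ, ∫ x : ℝ, z ^ k * ((x ^ k : ℝ) : ℂ) ∂ρ = (moment ρ k : ℂ) * z ^ k := by
      intro k
      rw [integral_const_mul, integral_complex_ofReal, mul_comm]
      rfl
    rw [e1] at key
    simpa only [e2] using key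

end CauchyTransform

/-! ### Jacobi parameters of the semicircular distribution -/

section Semicircle

-- These are rescaled Chebyshev polynomials of the second kind: under `x = b + 2 s cos θ` the
-- recurrence is the addition formula for `sin ((k + 3) θ) + sin ((k + 1) θ)`. The factor `sin θ`
-- avoids a division.
open Real in
theorem eval_jacobiPoly_cos (b s θ : ℝ) (k : ℕ) :
    (jacobiPoly (fun _ => b) (fun _ => s ^ 2) k).eval (b + 2 * s * cos θ) * sin θ
      = s ^ k * sin ((k + 1) * θ) := by
  induction k using Nat.strong_induction_on with
  | _ k ih =>
    match k, ih with
    | 0, _ => simp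
    | 1, _ =>
      simp only [jacobiPoly, eval_sub, eval_X, eval_C, Nat.cast_one]
      rw [show (1 + 1 : ℝ) * θ = 2 * θ by ring, sin_two_mul]
      ring
    | k + 2, ih =>
      have h1 := ih (k + 1) (by omega)
      have h2 := ih k (by omega)
      rw [jacobiPoly]
      simp only [eval_sub, eval_mul, eval_X, eval_C]
      have h3 : sin ((((k + 2 : ℕ) : ℝ) + 1) * θ) + sin (((k : ℝ) + 1) * θ)
          = 2 * sin ((((k + 1 : ℕ) : ℝ) + 1) * θ) * cos θ := by
        push_cast
        rw [show ((k : ℝ) + 2 + 1) * θ = (k + 1 + 1) * θ + θ by ring,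
          show ((k : ℝ) + 1) * θ = (k + 1 + 1) * θ - θ by ring, sin_add, sin_sub]
        ring
      linear_combination 2 * s * cos θ * h1 - s ^ 2 * h2 - s ^ (k + 2) * h3

/-- The density of the semicircular distribution. -/
noncomputable def semicircleDensity (b s x : ℝ) : ℝ :=
  Real.sqrt (4 * s ^ 2 - (x - b) ^ 2) / (2 * Real.pi * s ^ 2)

theorem semicircular_sq (b : ℝ) {s : ℝ} (hs : 0 < s) : semicircular b (s ^ 2) =
    volume.withDensity (fun x => ENNReal.ofReal (semicircleDensity b s x)) := by
  rw [semicircular, if_neg (pow_ne_zero 2 hs.ne')]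
  rfl

theorem semicircleDensity_nonneg (b s x : ℝ) : 0 ≤ semicircleDensity b s x := by
  unfold semicircleDensity
  positivity

theorem continuous_semicircleDensity (b s : ℝ) : Continuous (semicircleDensity b s) := by
  unfold semicircleDensity
  fun_prop

theorem abs_lt_of_semicircleDensity_ne_zero {b s x : ℝ} (hs : 0 < s)
    (h : semicircleDensity b s x ≠ 0) : |x - b| < 2 * s := by
  by_contra! hle
  apply h
  unfold semicircleDensity
  rw [Real.sqrt_eq_zero_of_nonpos, zero_div]
  nlinarith [sq_abs (x - b), abs_nonneg (x - b)]

theorem integrable_semicircleDensity (b : ℝ) {s : ℝ} (hs : 0 < s) :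
    Integrable (semicircleDensity b s) := by
  refine (continuous_semicircleDensity b s).integrable_of_hasCompactSupport ?_
  refine HasCompactSupport.intro (isCompact_closedBall b (2 * s)) fun x hx => ?_
  by_contra h
  exact hx (Metric.mem_closedBall.2 (abs_lt_of_semicircleDensity_ne_zero hs h).le)

-- Substituting `x = b + 2 s cos θ` turns the density into `sin θ / (π s)` and `dx` into `-2 s sin θ
-- dθ`. The two sines stay separate so that one can be absorbed by `eval_jacobiPoly_cos`.
open Real in
theorem integral_semicircleDensity_mul (b : ℝ) {s : ℝ} (hs : 0 < s) {f : ℝ → ℝ}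
    (hf : Continuous f) :
    ∫ x, semicircleDensity b s x * f x
      = 2 / π * ∫ θ in (0 : ℝ)..π, f (b + 2 * s * cos θ) * sin θ * sin θ := by
  have hsupp : Function.support (fun x => semicircleDensity b s x * f x)
      ⊆ Set.Ioc (b - 2 * s) (b + 2 * s) := by
    intro x hx
    have := abs_lt.1 (abs_lt_of_semicircleDensity_ne_zero hs (left_ne_zero_of_mul hx))
    constructor <;> linarith [this.1, this.2]
  rw [← intervalIntegral.integral_eq_integral_of_support_subset hsupp,
    intervalIntegral.integral_symm]
  have hsub := intervalIntegral.integral_comp_mul_deriv (a := 0) (b := π)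
    (f := fun θ => b + 2 * s * cos θ) (f' := fun θ => 2 * s * (-sin θ))
    (g := fun x => semicircleDensity b s x * f x)
    (fun θ _ => ((hasDerivAt_cos θ).const_mul (2 * s)).const_add b) (by fun_prop)
    ((continuous_semicircleDensity b s).mul hf)
  simp only [cos_zero, mul_one, cos_pi, mul_neg, ← sub_eq_add_neg] at hsub
  rw [← hsub, ← intervalIntegral.integral_neg, ← intervalIntegral.integral_const_mul]
  refine intervalIntegral.integral_congr fun θ hθ => ?_
  rw [Set.uIcc_of_le pi_pos.le] at hθ
  have hsin := sin_nonneg_of_nonneg_of_le_pi hθ.1 hθ.2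
  have hd : semicircleDensity b s (b + 2 * s * cos θ) = sin θ / (π * s) := by
    unfold semicircleDensity
    have : 4 * s ^ 2 - (b + 2 * s * cos θ - b) ^ 2 = (2 * s * sin θ) ^ 2 := by
      linear_combination (-4 * s ^ 2) * sin_sq_add_cos_sq θ
    rw [this, sqrt_sq (by positivity)]
    field_simp
  simp only [Function.comp, hd]
  field_simp

open Real in
theorem integral_sin_mul_sin (k : ℕ) :
    ∫ θ in (0 : ℝ)..π, sin (((k : ℝ) + 1 + 1) * θ) * sin θ = 0 := by
  have hcos : ∀ n : ℕ, ∫ θ in (0 : ℝ)..π, cos (((n : ℝ) + 1) * θ) = 0 := by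
    intro n
    have hn : (n : ℝ) + 1 ≠ 0 := by positivity
    rw [intervalIntegral.integral_comp_mul_left (fun x => cos x) hn, integral_cos]
    have := sin_nat_mul_pi (n + 1)
    push_cast at this
    simp [this]
  have e : ∀ θ : ℝ, sin (((k : ℝ) + 1 + 1) * θ) * sin θ
      = (cos (((k : ℝ) + 1) * θ) - cos ((((k + 2 : ℕ) : ℝ) + 1) * θ)) / 2 := by
    intro θ
    push_cast
    rw [show ((k : ℝ) + 1) * θ = (k + 1 + 1) * θ - θ by ring,
      show ((k : ℝ) + 2 + 1) * θ = (k + 1 + 1) * θ + θ by ring, cos_sub, cos_add]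
    ring
  simp only [e]
  rw [intervalIntegral.integral_div, intervalIntegral.integral_sub, hcos, hcos]
  · simp
  · exact Continuous.intervalIntegrable (by fun_prop) _ _
  · exact Continuous.intervalIntegrable (by fun_prop) _ _

theorem integral_semicircular (b : ℝ) {s : ℝ} (hs : 0 < s) (f : ℝ → ℝ) :
    ∫ x, f x ∂(semicircular b (s ^ 2)) = ∫ x, semicircleDensity b s x * f x := by
  rw [semicircular_sq b hs, integral_withDensity_eq_integral_toReal_smul
    ((continuous_semicircleDensity b s).measurable.ennreal_ofReal)
    (Eventually.of_forall fun _ => ENNReal.ofReal_lt_top)]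
  simp only [ENNReal.toReal_ofReal (semicircleDensity_nonneg b s _), smul_eq_mul]

theorem isProbabilityMeasure_semicircular_sq (b : ℝ) {s : ℝ} (hs : 0 < s) :
    IsProbabilityMeasure (semicircular b (s ^ 2)) := by
  refine ⟨?_⟩
  rw [semicircular_sq b hs, withDensity_apply _ MeasurableSet.univ, Measure.restrict_univ,
    ← ofReal_integral_eq_lintegral_ofReal (integrable_semicircleDensity b hs)
      (Eventually.of_forall (semicircleDensity_nonneg b s))]
  have := integral_semicircleDensity_mul b hs (f := fun _ => 1) continuous_const
  simp only [mul_one, one_mul, ← pow_two] at this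
  rw [this, integral_sin_sq]
  simp [Real.pi_ne_zero]

theorem abs_le_semicircular_sq (b : ℝ) {s : ℝ} (hs : 0 < s) :
    ∀ᵐ x ∂(semicircular b (s ^ 2)), |x| ≤ |b| + 2 * s := by
  rw [semicircular_sq b hs,
    ae_withDensity_iff (continuous_semicircleDensity b s).measurable.ennreal_ofReal]
  refine Eventually.of_forall fun x hx => ?_
  have hne : semicircleDensity b s x ≠ 0 := by
    intro h
    simp [h] at hx
  have h1 := abs_lt_of_semicircleDensity_ne_zero hs hne
  have h2 := abs_add_le (x - b) b
  rw [sub_add_cancel] at h2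
  linarith

/-- The semicircular distribution has constant Jacobi parameters. -/
theorem semicircular_isJacobi (b : ℝ) {c : ℝ} (hc : 0 ≤ c) :
    IsMomentLaw (semicircular b c) ∧ (∃ R > 0, ∀ᵐ x ∂(semicircular b c), |x| ≤ R) ∧
      IsJacobi (semicircular b c) (fun _ => b) (fun _ => c) := by
  rcases hc.eq_or_lt with rfl | hc
  · have e : semicircular b 0 = Measure.dirac b := by simp [semicircular]
    rw [e]
    have hb : ∀ᵐ x ∂(Measure.dirac b), |x| ≤ |b| + 1 := by
      rw [ae_dirac_iff (measurableSet_le (by fun_prop) (by fun_prop))]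
      linarith
    have hlaw := isMomentLaw_of_bounded hb
    refine ⟨hlaw, ⟨_, by positivity, hb⟩,
      hlaw.isJacobi_of_integral_eq_zero (fun _ => le_rfl) fun k => ?_⟩
    rw [integral_dirac]
    rcases k with - | k <;> simp [jacobiPoly]
  · obtain ⟨s, hs, rfl⟩ : ∃ s : ℝ, 0 < s ∧ s ^ 2 = c :=
      ⟨Real.sqrt c, Real.sqrt_pos.2 hc, Real.sq_sqrt hc.le⟩
    have := isProbabilityMeasure_semicircular_sq b hs
    have hb := abs_le_semicircular_sq b hs
    have hlaw := isMomentLaw_of_bounded hb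
    refine ⟨hlaw, ⟨_, by positivity, hb⟩,
      hlaw.isJacobi_of_integral_eq_zero (fun _ => hc.le) fun k => ?_⟩
    rw [integral_semicircular b hs, integral_semicircleDensity_mul b hs (by fun_prop)]
    simp only [eval_jacobiPoly_cos]
    simp only [mul_assoc]
    rw [intervalIntegral.integral_const_mul]
    push_cast
    rw [integral_sin_mul_sin]
    simp

end Semicircle

/-- No sign of `c + γ₀ t` is assumed, so the formula also applies to hypothetical roots whose formal
parameters would be negative. -/
theorem IsMomentLaw.moment_eq_of_freeCumulant {ν : Measure ℝ} (hν : IsMomentLaw ν)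
    {t β₀ γ₀ b c : ℝ}
    (h : ∀ n, 1 ≤ n → freeCumulant ν n = t * meixnerCumulant β₀ γ₀ b c n) (n : ℕ) :
    moment ν n
      = jacobiMoment (headTail (β₀ * t) (b + β₀ * t)) (headTail (γ₀ * t) (c + γ₀ * t)) n := by
  refine eq_of_freeCumulantOf_eq (by simp [hν.moment_zero]) (N := n + 1) ?_ n n.lt_succ_self
  intro k hk _
  rw [freeCumulantOf_meixner _ _ _ _ k hk, meixnerCumulant_smul, ← h k hk]
  rfl

/-! ### Free powers, infinite divisibility and the R-transform -/

section Converse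

variable {μ : Measure ℝ} {β₀ γ₀ b c : ℝ}

/-- The candidate parameters are nonnegative, so a compactly supported measure realizes them; it is
then the only measure of any kind with these moments. -/
theorem exists_isFreePower (hγ₀ : 0 ≤ γ₀)
    (hcum : ∀ n, 1 ≤ n → freeCumulant μ n = meixnerCumulant β₀ γ₀ b c n) {t : ℝ} (ht : 0 ≤ t)
    (htc : 0 ≤ c + t * γ₀) :
    ∃ ν : Measure ℝ, IsFreePower μ t ν ∧ (∀ ν' : Measure ℝ, IsFreePower μ t ν' → ν' = ν) ∧
      IsJacobi ν (headTail (β₀ * t) (b + β₀ * t)) (headTail (γ₀ * t) (c + γ₀ * t)) := by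
  obtain ⟨ν, hν, ⟨R, hR⟩, hJ⟩ := exists_isJacobi_headTail (β₀ * t) (b + β₀ * t)
    (mul_nonneg hγ₀ ht) (show 0 ≤ c + γ₀ * t by linarith)
  have hm := hν.moment_of_isJacobi hJ
  refine ⟨ν, ⟨hν, fun n hn => ?_⟩, fun ν' hν' => ?_, hJ⟩
  · rw [freeCumulant, funext hm, freeCumulantOf_meixner _ _ _ _ n hn, meixnerCumulant_smul,
      hcum n hn]
  · refine eq_of_moment_eq hν hν'.1 hR fun n => ?_
    rw [hm, hν'.1.moment_eq_of_freeCumulant fun n hn => (hν'.2 n hn).trans (by rw [hcum n hn])]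

theorem isFreelyInfinitelyDivisible_iff (hμ : IsMomentLaw μ) (hγ₀ : 0 ≤ γ₀) (hγ₁ : 0 ≤ c + γ₀)
    (hcum : ∀ n, 1 ≤ n → freeCumulant μ n = meixnerCumulant β₀ γ₀ b c n) :
    IsFreelyInfinitelyDivisible μ ↔ 0 ≤ c := by
  constructor
  · intro h
    by_contra! hc
    -- For this `n` the formal parameter `c + γ₀ / n` of the `n`-th root is negative, whereas `γ₀ >
    -- 0` because `c < 0 ≤ c + γ₀`. Then `γ₀ / n · (c + γ₀ / n) < 0` contradicts `gamma_mul_nonneg`.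
    obtain ⟨n, hn⟩ := exists_nat_gt (γ₀ / (-c))
    have hn0 : (0 : ℝ) < n := lt_of_le_of_lt (div_nonneg hγ₀ (by linarith)) hn
    obtain ⟨ν, hν, -, hpow⟩ := h n (by exact_mod_cast hn0)
    have hm := hν.moment_eq_of_freeCumulant (t := (n : ℝ)⁻¹) (β₀ := β₀) (γ₀ := γ₀) (b := b) (c := c)
      fun k hk => by
        rw [← hcum k hk, hpow k hk, inv_mul_cancel_left₀ hn0.ne']
    have hnn := hν.gamma_mul_nonneg hm
    simp only [headTail] at hnn
    have h1 : 0 < γ₀ * (n : ℝ)⁻¹ := mul_pos (by linarith) (inv_pos.2 hn0)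
    have h2 : γ₀ * (n : ℝ)⁻¹ < -c := by
      rwa [← div_eq_mul_inv, div_lt_iff₀ hn0, ← div_lt_iff₀' (by linarith)]
    nlinarith
  · intro hc n hn
    have hn0 : (0 : ℝ) < n := by exact_mod_cast hn
    obtain ⟨ν, hν, -⟩ := exists_isFreePower hγ₀ hcum (t := (n : ℝ)⁻¹) (by positivity)
      (by positivity)
    refine ⟨ν, hν.1, hμ, fun k hk => ?_⟩
    rw [hν.2 k hk, mul_inv_cancel_left₀ hn0.ne']

theorem hasSum_freeCumulant (hc : 0 ≤ c)
    (hcum : ∀ n, 1 ≤ n → freeCumulant μ n = meixnerCumulant β₀ γ₀ b c n) :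
    ∀ᶠ z : ℂ in 𝓝 0,
      Integrable (fun x : ℝ => (1 : ℂ) / (1 - z * (x : ℂ))) (semicircular b c) ∧
      HasSum (fun k : ℕ => (freeCumulant μ (k + 1) : ℂ) * z ^ (k + 1))
        ((β₀ : ℂ) * z + (γ₀ : ℂ) * z ^ 2 *
          ∫ x : ℝ, (1 : ℂ) / (1 - z * (x : ℂ)) ∂(semicircular b c)) := by
  obtain ⟨hlaw, ⟨R, hR0, hR⟩, hJ⟩ := semicircular_isJacobi b hc
  have := hlaw.isProbabilityMeasure
  filter_upwards [Metric.ball_mem_nhds (0 : ℂ) (inv_pos.2 hR0)] with z hz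
  rw [mem_ball_zero_iff] at hz
  obtain ⟨h1, h2⟩ := hasSum_moment hR0 hR hz
  refine ⟨h1, ?_⟩
  -- The term `β₀ z` is split off; the rest is `γ₀ z²` times the moment series of the semicircular
  -- law, since `r_{k+2} = γ₀ s_k`.
  rw [← hasSum_nat_add_iff' 1]
  have e1 : ∀ k : ℕ, (freeCumulant μ (k + 1 + 1) : ℂ) * z ^ (k + 1 + 1)
      = (γ₀ : ℂ) * z ^ 2 * ((moment (semicircular b c) k : ℂ) * z ^ k) := by
    intro k
    rw [hcum (k + 1 + 1) (by omega), hlaw.moment_of_isJacobi hJ]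
    simp only [meixnerCumulant]
    push_cast
    ring
  simpa [e1, hcum 1 le_rfl, meixnerCumulant] using h2.mul_left ((γ₀ : ℂ) * z ^ 2)

end Converse

end FreeMeixner

theorem mainTheorem2 (μ : MeasureTheory.Measure ℝ) (hμ : FreeMeixner.IsMomentLaw μ)
    (β γ : ℕ → ℝ) (hJ : FreeMeixner.IsJacobi μ β γ) :
    -- polynomial dependence on `t` of the Jacobi parameters of the free powers `ν t`
    (∀ (ν : ℕ → MeasureTheory.Measure ℝ) (B G : ℕ → ℕ → ℝ),
      (∀ t : ℕ, 1 ≤ t → FreeMeixner.IsFreePower μ t (ν t)) →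
      (∀ t : ℕ, 1 ≤ t → FreeMeixner.IsJacobi (ν t) (B t) (G t)) →
      (∀ m : ℕ, ∃ p q : Polynomial ℝ, ∀ t : ℕ, 1 ≤ t → FreeMeixner.IsGenuine (G t) m →
        B t m = p.eval (t : ℝ) ∧ G t m = q.eval (t : ℝ)) →
      FreeMeixner.ConstantFromOne β γ ∧ FreeMeixner.IsFreeMeixner μ) ∧
    -- the converse, with `b = β₁ - β₀` and `c = γ₁ - γ₀`
    (FreeMeixner.ConstantFromOne β γ → ∀ b c : ℝ, b = β 1 - β 0 → c = γ 1 - γ 0 →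
      (∀ t : ℝ, 0 ≤ t → 0 ≤ c + t * γ 0 →
        ∃ ν : MeasureTheory.Measure ℝ, FreeMeixner.IsFreePower μ t ν ∧
          (∀ ν' : MeasureTheory.Measure ℝ, FreeMeixner.IsFreePower μ t ν' → ν' = ν) ∧
          FreeMeixner.IsJacobi ν (FreeMeixner.headTail (β 0 * t) (b + β 0 * t))
            (FreeMeixner.headTail (γ 0 * t) (c + γ 0 * t))) ∧
      (FreeMeixner.IsFreelyInfinitelyDivisible μ ↔ 0 ≤ c) ∧
      (0 ≤ c →
        ∃ ρ : MeasureTheory.Measure ℝ, FreeMeixner.IsMomentLaw ρ ∧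
          FreeMeixner.IsJacobi ρ (fun _ => b) (fun _ => c) ∧
          ρ = FreeMeixner.semicircular b c ∧
          ∀ᶠ z : ℂ in nhds 0,
            MeasureTheory.Integrable (fun x : ℝ => (1 : ℂ) / (1 - z * (x : ℂ))) ρ ∧
            HasSum (fun k : ℕ => (FreeMeixner.freeCumulant μ (k + 1) : ℂ) * z ^ (k + 1))
              ((β 0 : ℂ) * z +
                (γ 0 : ℂ) * z ^ 2 * ∫ x : ℝ, (1 : ℂ) / (1 - z * (x : ℂ)) ∂ρ))) := by
  refine ⟨fun ν B G hν hνJ hpoly => ?_, fun hconst b c hb hc => ?_⟩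
  · have h := FreeMeixner.constantFromOne_of_polynomial hμ hJ hν hνJ hpoly
    exact ⟨h, h.isFreeMeixner hμ hJ⟩
  · have hcum := hconst.freeCumulant_eq hμ hJ
    rw [← hb, ← hc] at hcum
    refine ⟨fun t ht htc => FreeMeixner.exists_isFreePower (hJ.1 0) hcum ht htc,
      FreeMeixner.isFreelyInfinitelyDivisible_iff hμ (hJ.1 0) ?_ hcum, fun hc0 => ?_⟩
    · rw [hc, sub_add_cancel]
      exact hJ.1 1
    · obtain ⟨hlaw, -, hJρ⟩ := FreeMeixner.semicircular_isJacobi b hc0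
      exact ⟨_, hlaw, hJρ, rfl, FreeMeixner.hasSum_freeCumulant hc0 hcum⟩
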